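/- \textbf{A priori bounds.} For $\gamma\in\mathbb R$ let $\mathcal C^\gamma=B^\gamma_{\infty,\infty}(\mathbb R^d)$ be the space of real tempered distributions $f$ on $\mathbb R^d$ with $\|f\|_\gamma:=\sup_{j\ge 0}2^{\gamma j}\|(\phi_j\hat f)^\vee\|_{L^\infty}<\infty$, where $\phi_0$ is smooth with $\phi_0(x)=1$ for $|x|\le 1$ and $\phi_0(x)=0$ for $|x|\ge 3/2$, and $\phi_j(x)=\phi_0(2^{-j}x)-\phi_0(2^{-j+1}x)$ for $j\ge 1$. Let $P_t=e^{t\Delta}$ be the heat semigroup. Assume: (A1) $F:\mathbb R^d\to\mathbb R$ is of class $C^1$ and its partial derivatives are Lipschitz; (A2) $0<\alpha<1$, $\beta<0$ and $\max\{-\alpha,\alpha-1\}<\beta$; (A3) $b\in L^\infty([0,T];\mathcal C^\beta)$, where $0<T<\infty$; (A4) $F$ is globally Lipschitz; and let $u_0\in\mathcal C^{\alpha+1}$. Then there is a finite constant $K$, which (for fixed $d$, $\phi_0$, $\alpha$, $\beta$ and $F$) depends only on $T$, $b$ and $u_0$, with the following property. For every $\lambda\in[0,1]$ and every $u\in C([0,T];\mathcal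 C^{\alpha+1})$ such that $$u(t)=\lambda P_tu_0+\lambda\int_0^tP_{t-r}\big(F(\nabla u(r))\,b(r)\big)\,dr\qquad\text{for all }t\in[0,T],$$ one has $\|u(t)\|_{\alpha+1}\le K$ for all $t\in[0,T]$; in particular $\sup_{t\in[0,T]}\|u(t)\|_{\alpha+1}\le K$. Here the product of $f=F(\nabla u(r))\in\mathcal C^\alpha$ and $g=b(r)\in\mathcal C^\beta$ is Bony's product $fg=\lim_{n\to\infty}(S_nf)(S_ng)$ in the space of tempered distributions, with $S_nf=\sum_{j<n}(\phi_j\hat f)^\vee$, and the integral is that of functions of time with values in the tempered distributions (in the weak sense, tested against Schwartz functions). -/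

import Mathlib

open MeasureTheory Filter Topology
open scoped ENNReal NNReal SchwartzMap ContDiff LineDeriv

noncomputable section

namespace RoughPDE

/-- The Euclidean space `ℝ^d`. -/
abbrev Rd (d : ℕ) : Type := EuclideanSpace ℝ (Fin d)

/-- Complex tempered distributions on `ℝ^d`; the real ones are singled out by `IsReal`. -/
abbrev Dist (d : ℕ) : Type := 𝓢'(Rd d, ℂ)

variable {d : ℕ}

/-- A distribution is real if it takes real values on real test functions. -/
def IsReal (f : Dist d) : Prop :=
  ∀ ψ : 𝓢(Rd d, ℂ), (∀ x, (ψ x).im = 0) → (f ψ).im = 0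

/-! ### Distributions given by essentially bounded functions -/

open Classical in
/-- The distribution `ψ ↦ ∫ ψ g` given by an essentially bounded function `g`
(and `0` if `g` is not essentially bounded). -/
def ofFun (g : Rd d → ℂ) : Dist d :=
  if h : MemLp g ∞ (volume : Measure (Rd d)) then Lp.toTemperedDistribution (h.toLp g) else 0

/-- The `L^∞` norm of a distribution: the norm of the (unique) `L^∞` function that represents it,
and `∞` if there is none. -/
def linftyNorm (f : Dist d) : ℝ≥0∞ :=
  ⨅ (g : Lp ℂ ∞ (volume : Measure (Rd d))) (_ : Lp.toTemperedDistribution g = f), ‖g‖ₑ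

open Classical in
/-- The `L^∞` function that represents `f` (and `0` if there is none). -/
def linftyRep (f : Dist d) : Lp ℂ ∞ (volume : Measure (Rd d)) :=
  if h : ∃ g : Lp ℂ ∞ (volume : Measure (Rd d)), Lp.toTemperedDistribution g = f
  then h.choose else 0

/-! ### Littlewood-Paley blocks and the spaces `C^γ = B^γ_{∞,∞}` -/

/-- The zeroth function `φ₀` of a smooth dyadic partition of unity. -/
structure DyadicCutoff (d : ℕ) where
  toFun : Rd d → ℝ
  smooth : ContDiff ℝ ∞ toFun
  eq_one : ∀ x, ‖x‖ ≤ 1 → toFun x = 1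
  eq_zero : ∀ x, 3 / 2 ≤ ‖x‖ → toFun x = 0

/-- The dyadic partition of unity: `φ_j (x) = φ₀ (2^{-j} x) - φ₀ (2^{-j+1} x)` for `j ≥ 1`. -/
def DyadicCutoff.part (φ : DyadicCutoff d) : ℕ → Rd d → ℝ
  | 0 => φ.toFun
  | j + 1 => fun x =>
      φ.toFun (((2 : ℝ) ^ (j + 1))⁻¹ • x) - φ.toFun (((2 : ℝ) ^ j)⁻¹ • x)

/-- The Littlewood-Paley block `Δ_j f = (φ_j f̂)^∨`. -/
def block (φ : DyadicCutoff d) (j : ℕ) (f : Dist d) : Dist d :=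
  TemperedDistribution.fourierMultiplierCLM ℂ (fun ξ => ((φ.part j ξ : ℝ) : ℂ)) f

/-- The norm `‖f‖_γ = sup_j 2^{γ j} ‖Δ_j f‖_{L^∞}`, with values in `[0, ∞]`. -/
def besovNorm (φ : DyadicCutoff d) (γ : ℝ) (f : Dist d) : ℝ≥0∞ :=
  ⨆ j : ℕ, ENNReal.ofReal ((2 : ℝ) ^ (γ * (j : ℝ))) * linftyNorm (block φ j f)

/-- `f ∈ C^γ`: a real distribution with finite norm. -/
def MemC (φ : DyadicCutoff d) (γ : ℝ) (f : Dist d) : Prop :=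
  IsReal f ∧ besovNorm φ γ f < ⊤

/-! ### Product of a function and a distribution, in the sense of Bony -/

/-- `S_n f = ∑_{j < n} Δ_j f`. -/
def partialSum (φ : DyadicCutoff d) (n : ℕ) (f : Dist d) : Dist d :=
  ∑ j ∈ Finset.range n, block φ j f

/-- The pointwise product of two distributions that are `L^∞` functions. -/
def mulLinfty (f g : Dist d) : Dist d :=
  ofFun (fun x => linftyRep f x * linftyRep g x)

/-- The product `f g = ∑_{i,j} Δ_i f Δ_j g = lim_n (S_n f) (S_n g)`, the limit being taken
in the space of tempered distributions. -/
def bonyMul (φ : DyadicCutoff d) (f g : Dist d) : Dist d :=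
  limUnder atTop (fun n : ℕ => mulLinfty (partialSum φ n f) (partialSum φ n g))

/-! ### The nonlinear term and the heat semigroup -/

/-- `g` is a bounded continuous function that represents the distributional gradient of `f`. -/
def IsGradient (f : Dist d) (g : Rd d → Rd d) : Prop :=
  Continuous g ∧ (∃ M : ℝ, ∀ x, ‖g x‖ ≤ M) ∧
    ∀ i : Fin d, ∂_{(EuclideanSpace.single i (1 : ℝ) : Rd d)} f = ofFun (fun x => ((g x i : ℝ) : ℂ))

open Classical in
/-- The gradient of `f`, as a bounded continuous function (`0` if there is no such gradient). -/
def grad (f : Dist d) : Rd d → Rd d :=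
  if h : ∃ g, IsGradient f g then h.choose else 0

/-- The function `x ↦ F (∇f (x))`, as a distribution. -/
def compGrad (F : Rd d → ℝ) (f : Dist d) : Dist d :=
  ofFun (fun x => ((F (grad f x) : ℝ) : ℂ))

/-- The heat semigroup `P_t = e^{tΔ}`, `t ≥ 0`: the Fourier multiplier `exp (-t |2πξ|^2)`, where
`ξ` is the frequency variable for the Fourier transform `∫ e^{-2πi x·ξ} f(x) dx`. -/
def heat (t : ℝ) (f : Dist d) : Dist d :=
  TemperedDistribution.fourierMultiplierCLM ℂ
    (fun ξ => ((Real.exp (-t * (2 * Real.pi * ‖ξ‖) ^ 2) : ℝ) : ℂ)) f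

/-! ### Spaces of functions of time -/

/-- `u ∈ C([0,T]; C^γ)`. -/
def MemCT (φ : DyadicCutoff d) (T γ : ℝ) (u : ℝ → Dist d) : Prop :=
  (∀ t ∈ Set.Icc 0 T, MemC φ γ (u t)) ∧
    ∀ t ∈ Set.Icc 0 T,
      Tendsto (fun s => besovNorm φ γ (u s - u t)) (𝓝[Set.Icc 0 T] t) (𝓝 0)

/-- The norm `sup_{t ∈ [0,T]} ‖u(t)‖_γ`. -/
def normCT (φ : DyadicCutoff d) (T γ : ℝ) (u : ℝ → Dist d) : ℝ≥0∞ :=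
  ⨆ t ∈ Set.Icc 0 T, besovNorm φ γ (u t)

/-- `b ∈ L^∞([0,T]; C^γ)`: `b` is strongly measurable (the almost everywhere limit, in the norm of
`C^γ`, of simple functions with values in `C^γ`) and essentially bounded. -/
def MemLinftyT (φ : DyadicCutoff d) (T γ : ℝ) (b : ℝ → Dist d) : Prop :=
  (∀ᵐ r ∂(volume.restrict (Set.Icc 0 T)), MemC φ γ (b r)) ∧
    (∃ s : ℕ → SimpleFunc ℝ (Dist d), (∀ n r, MemC φ γ (s n r)) ∧
      ∀ᵐ r ∂(volume.restrict (Set.Icc 0 T)),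
        Tendsto (fun n => besovNorm φ γ (s n r - b r)) atTop (𝓝 0)) ∧
    essSup (fun r => besovNorm φ γ (b r)) (volume.restrict (Set.Icc 0 T)) < ⊤

/-- The equation `u(t) = lam P_t u₀ + lam ∫₀ᵗ P_{t-r} (F(∇u(r)) b(r)) dr`, `t ∈ [0,T]`; the
integral of distributions is the weak one, defined by pairing with test functions. -/
def IsMildSolution (φ : DyadicCutoff d) (F : Rd d → ℝ) (T lam : ℝ) (b : ℝ → Dist d)
    (u₀ : Dist d) (u : ℝ → Dist d) : Prop :=
  ∀ t ∈ Set.Icc 0 T, ∀ ψ : 𝓢(Rd d, ℂ),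
    u t ψ = (lam : ℂ) * heat t u₀ ψ +
      (lam : ℂ) * ∫ r in (0 : ℝ)..t, heat (t - r) (bonyMul φ (compGrad F (u r)) (b r)) ψ

end RoughPDE

end

noncomputable section

namespace RoughPDE

variable {d : ℕ}

/-! The nonlinear term grows at most linearly in `u`, so a Gronwall argument in an exponentially
weighted norm closes the estimate. Fix `a` with `-β < a < min α (1 - α)`, which the condition on `β`
permits. If `u(r)` has `C^{α+1}` norm at most `N`, its gradient is bounded and `a`-Hölder with
constant `O(N)` (`norm_gradient_le`), and the Lipschitz function `F` turns this into `O(1+N)` for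
`F(∇u(r))` (`norm_comp_grad_le`). Because `a + β > 0`, the product with `b(r)` converges and is
bounded by `O(1+N)` on test functions measured by their `L¹` norm and their `L¹`-Hölder constant of
exponent `a` (`norm_bonyMul_apply_le`); morally it has regularity `-a`. The heat semigroup lifts it
to `C^{α+1}` at the cost `s^{-θ}`, `θ = (α+1+a)/2` (`norm_block_heat_apply_le_of_l1Holder`), and `θ
< 1` because `a < 1 - α`, so the singularity is integrable in time.

If `‖u(r)‖ ≤ N e^{ρr}`, the room left below exponent `1` is spent on `e^{-ρ(t-r)} ≤ (ρ(t-r))^{-ε}`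
with `θ + ε < 1`, so the integral term is at most `C₁ ρ^{-ε} (1+N) e^{ρt}` (`besovNorm_mild_le`).
Take `ρ` with `C₁ ρ^{-ε} ≤ 1/2`. The least possible `N`, finite by continuity of `u` on a compact
interval, then satisfies `N ≤ C₀ + (1+N)/2`, hence `N ≤ 2C₀ + 1` (`exists_bound_mild`). No constant
depends on `u` or on `λ ∈ [0,1]`.

Bounds on distributions are obtained by duality: an `L^∞` bound is a bound of `f ψ` by a multiple of
the `L¹` norm of `ψ`, and Fourier multipliers are moved to `ψ`, where they act as convolutions with
dilates of fixed Schwartz kernels. This suits the weak time integral: each test function yields a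
scalar inequality, for which no measurability in time is needed. -/

/-! ### Averages of translates -/

/-- The action on test functions dual to the Fourier multiplier with symbol `g`. -/
def adjMult (g : Rd d → ℂ) (ψ : 𝓢(Rd d, ℂ)) : 𝓢(Rd d, ℂ) :=
  FourierTransform.fourier (SchwartzMap.smulLeftCLM ℂ g (FourierTransform.fourierInv ψ))

/-- The convolution of `χ` with the dilate `l^{-d} K(·/l)`. -/
def dilConv (K : 𝓢(Rd d, ℂ)) (l : ℝ) (χ : Rd d → ℂ) (x : Rd d) : ℂ :=
  ∫ y, K y * χ (x - l • y)

theorem fourierMultiplier_apply (g : Rd d → ℂ) (f : Dist d) (ψ : 𝓢(Rd d, ℂ)) :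
    TemperedDistribution.fourierMultiplierCLM ℂ g f ψ = f (adjMult g ψ) := rfl

theorem hasTemperateGrowth_dilate (m : 𝓢(Rd d, ℂ)) (l : ℝ) :
    Function.HasTemperateGrowth (fun ξ : Rd d => m (l • ξ)) :=
  m.hasTemperateGrowth.comp
    (f := fun ξ : Rd d => l • ξ) (l • ContinuousLinearMap.id ℝ (Rd d)).hasTemperateGrowth

/-- A multiplier with dilated symbol is a convolution. Writing `m (l ξ)` as a Fourier integral of
`K` for the pairing `-l ⟨·,·⟩` and using the self-adjointness of the Fourier integral avoids a
change of variables. -/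
theorem adjMult_dilate_apply (m : 𝓢(Rd d, ℂ)) (l : ℝ) (ψ : 𝓢(Rd d, ℂ)) (x : Rd d) :
    adjMult (fun ξ => m (l • ξ)) ψ x = dilConv (FourierTransform.fourier m) l ψ x := by
  set K := FourierTransform.fourier m with hK
  set p := FourierTransform.fourierInv ψ with hp
  have hm : m = FourierTransform.fourierInv K := by simp [hK]
  have hψ : ψ = FourierTransform.fourier p := by simp [hp]
  have h1 : adjMult (fun ξ => m (l • ξ)) ψ x
      = ∫ ξ, VectorFourier.fourierIntegral Real.fourierChar volume ((-l) • innerₗ (Rd d)) K ξ •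
        (Real.fourierChar (-inner ℝ ξ x) • p ξ) := by
    rw [adjMult, SchwartzMap.fourier_coe, Real.fourier_eq]
    congr 1; ext ξ
    rw [SchwartzMap.smulLeftCLM_apply_apply (hasTemperateGrowth_dilate m l)]
    rw [smul_comm]
    congr 1
    rw [hm, SchwartzMap.fourierInv_coe, Real.fourierInv_eq]
    simp [VectorFourier.fourierIntegral, inner_smul_right]
  rw [h1, VectorFourier.integral_fourierIntegral_smul_eq_flip Real.continuous_fourierChar]
  · simp only [dilConv, smul_eq_mul]
    congr 1; ext y
    congr 1
    rw [hψ, SchwartzMap.fourier_coe, Real.fourier_eq]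
    simp only [VectorFourier.fourierIntegral]
    congr 1; ext ξ
    rw [smul_smul, ← AddChar.map_add_eq_mul]
    congr 2
    simp [inner_sub_right, inner_smul_right, real_inner_comm]
    ring
  · simp only [LinearMap.smul_apply, innerₗ_apply_apply]; fun_prop
  · exact K.integrable
  · have : Continuous fun ξ : Rd d => (Real.fourierChar (-inner ℝ ξ x) : ℂ) := by fun_prop
    refine (p.integrable (μ := volume)).bdd_mul (c := 1) this.aestronglyMeasurable ?_ |>.congr ?_
    · exact Eventually.of_forall fun ξ => (Circle.norm_coe _).le
    · exact Eventually.of_forall fun ξ => by simp [Circle.smul_def]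

theorem integral_fourier_eq (m : 𝓢(Rd d, ℂ)) :
    ∫ y, (FourierTransform.fourier m : 𝓢(Rd d, ℂ)) y = m 0 := by
  have h : m = FourierTransform.fourierInv (FourierTransform.fourier m) := by simp
  conv_rhs => rw [h, SchwartzMap.fourierInv_coe, Real.fourierInv_eq]
  simp

/-- Minkowski's integral inequality in `L¹`. -/
theorem integral_norm_integral_le {Y : Type*} [TopologicalSpace Y] [SecondCountableTopology Y]
    [MeasurableSpace Y] [BorelSpace Y] {μ : Measure Y} [SFinite μ] {Φ : Y → Rd d → ℂ}
    (hc : Continuous (Function.uncurry Φ)) (hi : ∀ y, Integrable (Φ y)) {w : Y → ℝ}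
    (hw : Integrable w μ) (hle : ∀ y, ∫ x, ‖Φ y x‖ ≤ w y) :
    Integrable (fun x : Rd d => ∫ y, Φ y x ∂μ) ∧ ∫ x, ‖∫ y, Φ y x ∂μ‖ ≤ ∫ y, w y ∂μ := by
  have hm : AEStronglyMeasurable (Function.uncurry Φ) (μ.prod volume) := hc.aestronglyMeasurable
  have hn : Integrable (fun y => ∫ x : Rd d, ‖Φ y x‖) μ := by
    refine hw.mono' hm.norm.integral_prod_right' (Eventually.of_forall fun y => ?_)
    rw [Real.norm_of_nonneg (integral_nonneg fun _ => norm_nonneg _)]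
    exact hle y
  have hint : Integrable (Function.uncurry Φ) (μ.prod volume) :=
    (integrable_prod_iff hm).2 ⟨Eventually.of_forall hi, hn⟩
  refine ⟨hint.integral_prod_right, ?_⟩
  calc ∫ x, ‖∫ y, Φ y x ∂μ‖ ≤ ∫ x, ∫ y, ‖Φ y x‖ ∂μ :=
        integral_mono hint.integral_prod_right.norm hint.norm.integral_prod_right
          fun x => norm_integral_le_integral_norm _
    _ = ∫ y, (∫ x, ‖Φ y x‖) ∂μ := (integral_integral_swap hint.norm).symm
    _ ≤ ∫ y, w y ∂μ := integral_mono hn hw hle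

theorem continuous_dilConv_integrand (K : 𝓢(Rd d, ℂ)) (l : ℝ) {χ : Rd d → ℂ}
    (hχ : Continuous χ) :
    Continuous (Function.uncurry fun (y x : Rd d) => K y * χ (x - l • y)) := by
  have := K.continuous
  simp only [Function.uncurry_def]
  fun_prop

/-- Young's inequality. With the dilation placed on the argument of `χ`, the bound is uniform in
`l`. -/
theorem dilConv_norm_le (K : 𝓢(Rd d, ℂ)) (l : ℝ) {χ : Rd d → ℂ} (hχ : Continuous χ)
    (hi : Integrable χ) :
    Integrable (dilConv K l χ) ∧ ∫ x, ‖dilConv K l χ x‖ ≤ (∫ y, ‖K y‖) * ∫ x, ‖χ x‖ := by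
  have := integral_norm_integral_le (μ := volume) (continuous_dilConv_integrand K l hχ)
    (fun y => (hi.comp_sub_right (l • y)).const_mul (K y))
    (w := fun y => ‖K y‖ * ∫ x, ‖χ x‖) (K.integrable.norm.mul_const _) fun y => by
      simp only [norm_mul]
      rw [integral_const_mul, integral_sub_right_eq_self (fun x => ‖χ x‖)]
  rwa [integral_mul_const] at this

/-- `A` bounds the Hölder constant of exponent `a` of `χ` with respect to the `L¹` norm. -/
def L1Holder (a : ℝ) (χ : Rd d → ℂ) (A : ℝ) : Prop :=
  ∀ h : Rd d, ∫ x, ‖χ (x + h) - χ x‖ ≤ A * ‖h‖ ^ a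

theorem rpow_le_one_add {x a : ℝ} (hx : 0 ≤ x) (ha : 0 ≤ a) (ha1 : a ≤ 1) : x ^ a ≤ 1 + x := by
  rcases le_total x 1 with h | h
  · linarith [Real.rpow_le_one hx h ha]
  · have := Real.rpow_le_rpow_of_exponent_le h ha1
    rw [Real.rpow_one] at this; linarith

theorem integrable_norm_mul_norm_rpow (K : 𝓢(Rd d, ℂ)) {a : ℝ} (ha : 0 ≤ a) (ha1 : a ≤ 1) :
    Integrable fun y => ‖K y‖ * ‖y‖ ^ a := by
  have h := K.integrable_pow_mul volume 1
  refine (K.integrable.norm.add h).mono' ?_ (Eventually.of_forall fun y => ?_)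
  · have := K.continuous
    have : Continuous fun y : Rd d => ‖K y‖ * ‖y‖ ^ a :=
      this.norm.mul (continuous_norm.rpow_const fun _ => Or.inr ha)
    exact this.aestronglyMeasurable
  · rw [Real.norm_of_nonneg (by positivity)]
    have := rpow_le_one_add (norm_nonneg y) ha ha1
    simp only [Pi.add_apply, pow_one]
    nlinarith [norm_nonneg (K y)]

/-- Since `K` has mean zero, `χ x` may be subtracted under the integral; the remaining increment
over `l y` gains `l ^ a`. This cancellation is the source of the decay of high frequency pairings.
-/
theorem dilConv_norm_le_of_integral_eq_zero (K : 𝓢(Rd d, ℂ)) (hK : ∫ y, K y = 0) {l a A M : ℝ}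
    (hl : 0 ≤ l) (ha : 0 ≤ a) (ha1 : a ≤ 1) {χ : Rd d → ℂ} (hχ : Continuous χ)
    (hi : Integrable χ) (hb : ∀ x, ‖χ x‖ ≤ M) (hA : L1Holder a χ A) :
    ∫ x, ‖dilConv K l χ x‖ ≤ (∫ y, ‖K y‖ * ‖y‖ ^ a) * (A * l ^ a) := by
  have hKc := K.continuous
  have e : ∀ x, dilConv K l χ x = ∫ y, K y * (χ (x - l • y) - χ x) := fun x => by
    simp only [mul_sub]
    rw [integral_sub, integral_mul_const, hK, zero_mul, sub_zero, dilConv]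
    · refine (K.integrable (μ := volume)).mul_bdd (c := M) ?_ (Eventually.of_forall fun y => hb _)
      exact (by fun_prop : Continuous fun y : Rd d => χ (x - l • y)).aestronglyMeasurable
    · exact K.integrable.mul_const _
  simp only [e]
  have := (integral_norm_integral_le (μ := volume)
    (Φ := fun (y x : Rd d) => K y * (χ (x - l • y) - χ x))
    (by simp only [Function.uncurry_def]; fun_prop)
    (fun y => ((hi.comp_sub_right (l • y)).sub hi).const_mul (K y))
    (w := fun y => ‖K y‖ * ‖y‖ ^ a * (A * l ^ a))
    ((integrable_norm_mul_norm_rpow K ha ha1).mul_const _) fun y => ?_).2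
  · rwa [integral_mul_const] at this
  · simp only [norm_mul]
    rw [integral_const_mul, mul_assoc]
    refine mul_le_mul_of_nonneg_left ?_ (norm_nonneg _)
    have := hA (-(l • y))
    rw [norm_neg, norm_smul, Real.norm_of_nonneg hl, Real.mul_rpow hl (norm_nonneg _)] at this
    simp only [sub_eq_add_neg] at this ⊢
    linarith

/-! ### Translations of Schwartz functions -/

theorem integral_norm_translate_sub_le (K : 𝓢(Rd d, ℂ)) (h : Rd d) :
    ∫ x, ‖K (x + h) - K x‖ ≤ ‖h‖ * ∫ x, ‖fderiv ℝ K x‖ := by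
  have hd : ∀ x, HasFDerivAt K (fderiv ℝ K x) x := fun x => K.hasFDerivAt x
  have hc : Continuous (fderiv ℝ K) := (SchwartzMap.fderivCLM ℝ (Rd d) ℂ K).continuous
  have hi : Integrable (fderiv ℝ K) (volume : Measure (Rd d)) :=
    (SchwartzMap.fderivCLM ℝ (Rd d) ℂ K).integrable
  have e : ∀ x, K (x + h) - K x
      = ∫ s, fderiv ℝ K (x + s • h) h ∂(volume.restrict (Set.Ioc (0 : ℝ) 1)) := fun x => by
    rw [← intervalIntegral.integral_of_le zero_le_one]
    have := intervalIntegral.integral_eq_sub_of_hasDerivAt (a := (0 : ℝ)) (b := 1)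
      (f := fun s : ℝ => K (x + s • h)) (f' := fun s => fderiv ℝ K (x + s • h) h)
      (fun s _ => by
        have h2 : HasDerivAt (fun s : ℝ => x + s • h) h s := by
          simpa using ((hasDerivAt_id s).smul_const h).const_add x
        exact (hd (x + s • h)).comp_hasDerivAt s h2)
      (by apply Continuous.intervalIntegrable; fun_prop)
    rw [this]; simp
  simp only [e]
  have hb : ∀ s : ℝ, ∀ x, ‖fderiv ℝ K (x + s • h) h‖ ≤ ‖fderiv ℝ K (x + s • h)‖ * ‖h‖ :=
    fun s x => ContinuousLinearMap.le_opNorm _ _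
  have hi2 : ∀ s : ℝ, Integrable fun x => ‖fderiv ℝ K (x + s • h)‖ * ‖h‖ := fun s =>
    ((hi.comp_add_right (s • h)).norm).mul_const _
  have hi1 : ∀ s : ℝ, Integrable fun x => fderiv ℝ K (x + s • h) h := fun s =>
    (hi2 s).mono' (by
      exact (by fun_prop : Continuous fun x => fderiv ℝ K (x + s • h) h).aestronglyMeasurable)
      (Eventually.of_forall (hb s))
  have := (integral_norm_integral_le (μ := volume.restrict (Set.Ioc (0 : ℝ) 1))
    (Φ := fun (s : ℝ) (x : Rd d) => fderiv ℝ K (x + s • h) h)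
    (by simp only [Function.uncurry_def]; fun_prop) hi1
    (w := fun _ => ‖h‖ * ∫ x, ‖fderiv ℝ K x‖) (integrable_const _) fun s => ?_).2
  · simpa using this
  · refine (integral_mono (hi1 s).norm (hi2 s) (hb s)).trans ?_
    rw [integral_mul_const, integral_add_right_eq_self (fun x => ‖fderiv ℝ K x‖), mul_comm]

/-- The norm of `W^{1,1}`. -/
def w11 (K : 𝓢(Rd d, ℂ)) : ℝ := (∫ x, ‖K x‖) + ∫ x, ‖fderiv ℝ K x‖

theorem w11_nonneg (K : 𝓢(Rd d, ℂ)) : 0 ≤ w11 K :=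
  add_nonneg (integral_nonneg fun _ => norm_nonneg _) (integral_nonneg fun _ => norm_nonneg _)

theorem integral_norm_le_w11 (K : 𝓢(Rd d, ℂ)) : ∫ x, ‖K x‖ ≤ w11 K :=
  le_add_of_nonneg_right (integral_nonneg fun _ => norm_nonneg _)

/-- For `‖h‖ ≤ 1` the derivative controls the increment, for `‖h‖ ≥ 1` the triangle inequality does.
-/
theorem l1Holder_schwartz (K : 𝓢(Rd d, ℂ)) {a : ℝ} (ha : 0 ≤ a) (ha1 : a ≤ 1) :
    L1Holder a K (2 * w11 K) := fun h => by
  have h0 : 0 ≤ ∫ x, ‖K x‖ := integral_nonneg fun x => norm_nonneg _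
  have h0' : 0 ≤ ∫ x, ‖fderiv ℝ K x‖ := integral_nonneg fun x => norm_nonneg _
  rcases le_total ‖h‖ 1 with h1 | h1
  · have h2 : ‖h‖ ≤ ‖h‖ ^ a := by
      rcases (norm_nonneg h).eq_or_lt with h3 | h3
      · rw [← h3]; exact Real.rpow_nonneg le_rfl _
      · simpa using Real.rpow_le_rpow_of_exponent_ge h3 h1 ha1
    refine (integral_norm_translate_sub_le K h).trans ?_
    rw [mul_comm]
    refine mul_le_mul ?_ h2 (norm_nonneg _) (by linarith [w11_nonneg K])
    simp only [w11]; linarith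
  · have h2 : 1 ≤ ‖h‖ ^ a := Real.one_le_rpow h1 ha
    have h3 : ∫ x, ‖K (x + h) - K x‖ ≤ 2 * ∫ x, ‖K x‖ := by
      have hs := (K.integrable (μ := volume)).comp_add_right h
      calc ∫ x, ‖K (x + h) - K x‖ ≤ ∫ x, (‖K (x + h)‖ + ‖K x‖) :=
            integral_mono (hs.sub K.integrable).norm (hs.norm.add K.integrable.norm)
              fun x => norm_sub_le _ _
        _ = 2 * ∫ x, ‖K x‖ := by
          rw [integral_add hs.norm K.integrable.norm,
            integral_add_right_eq_self (fun x => ‖K x‖)]; ring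
    refine h3.trans ?_
    have := w11_nonneg K
    calc 2 * ∫ x, ‖K x‖ ≤ 2 * w11 K * 1 := by simp only [w11]; linarith
      _ ≤ _ := by gcongr

/-- Translating the convolution by `h` amounts to translating `K` by `h / l`, so smoothness comes
from the kernel alone and only the `L¹` norm of `χ` enters. This is a Bernstein inequality with a
fractional derivative. -/
theorem l1Holder_dilConv (K : 𝓢(Rd d, ℂ)) {l a : ℝ} (hl : 0 < l) (ha : 0 ≤ a) (ha1 : a ≤ 1)
    {χ : Rd d → ℂ} (hχ : Continuous χ) (hi : Integrable χ) {M : ℝ} (hb : ∀ x, ‖χ x‖ ≤ M) :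
    L1Holder a (dilConv K l χ) (2 * w11 K * (∫ x, ‖χ x‖) * (l⁻¹) ^ a) := fun h => by
  set K' : 𝓢(Rd d, ℂ) := SchwartzMap.compSubConstCLM ℂ (-(l⁻¹ • h)) K - K with hK'
  have hK'a : ∀ y, K' y = K (y + l⁻¹ • h) - K y := fun y => by simp [hK']
  have hint : ∀ (K : 𝓢(Rd d, ℂ)) (x : Rd d), Integrable fun y => K y * χ (x - l • y) :=
    fun K x => (K.integrable (μ := volume)).mul_bdd (c := M)
      (by fun_prop : Continuous fun y : Rd d => χ (x - l • y)).aestronglyMeasurable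
      (Eventually.of_forall fun y => hb _)
  have e : ∀ x, dilConv K l χ (x + h) - dilConv K l χ x = dilConv K' l χ x := fun x => by
    have h1 : dilConv K l χ (x + h) = ∫ y, K (y + l⁻¹ • h) * χ (x - l • y) := by
      rw [dilConv, ← integral_add_right_eq_self _ (l⁻¹ • h)]
      congr 1; ext y; congr 2
      rw [smul_add, smul_smul, mul_inv_cancel₀ hl.ne', one_smul]; abel
    rw [h1]
    simp only [dilConv, hK'a, sub_mul]
    rw [integral_sub _ (hint K x)]
    have := hint (SchwartzMap.compSubConstCLM ℂ (-(l⁻¹ • h)) K) x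
    simpa using this
  simp only [e]
  refine (dilConv_norm_le K' l hχ hi).2.trans ?_
  have h2 := l1Holder_schwartz K ha ha1 (l⁻¹ • h)
  rw [norm_smul, Real.norm_of_nonneg (by positivity),
    Real.mul_rpow (by positivity) (norm_nonneg _)] at h2
  simp only [hK'a]
  calc _ ≤ 2 * w11 K * (l⁻¹ ^ a * ‖h‖ ^ a) * ∫ x, ‖χ x‖ :=
        mul_le_mul_of_nonneg_right h2 (integral_nonneg fun _ => norm_nonneg _)
    _ = _ := by ring

theorem adjMult_dilate_norm_le (m : 𝓢(Rd d, ℂ)) (l : ℝ) (ψ : 𝓢(Rd d, ℂ)) :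
    ∫ x, ‖adjMult (fun ξ => m (l • ξ)) ψ x‖
      ≤ w11 (FourierTransform.fourier m : 𝓢(Rd d, ℂ)) * ∫ x, ‖ψ x‖ := by
  simp only [adjMult_dilate_apply]
  refine (dilConv_norm_le _ l ψ.continuous ψ.integrable).2.trans ?_
  exact mul_le_mul_of_nonneg_right (integral_norm_le_w11 _) (integral_nonneg fun _ => norm_nonneg _)

theorem l1Holder_adjMult_dilate (m : 𝓢(Rd d, ℂ)) {l a : ℝ} (hl : 0 < l) (ha : 0 ≤ a)
    (ha1 : a ≤ 1) (ψ : 𝓢(Rd d, ℂ)) :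
    L1Holder a (adjMult (fun ξ => m (l • ξ)) ψ)
      (2 * w11 (FourierTransform.fourier m : 𝓢(Rd d, ℂ)) * (∫ x, ‖ψ x‖) * (l⁻¹) ^ a) := by
  have : (adjMult (fun ξ => m (l • ξ)) ψ : Rd d → ℂ)
      = dilConv (FourierTransform.fourier m) l ψ := funext fun x => adjMult_dilate_apply m l ψ x
  rw [this]
  exact l1Holder_dilConv _ hl ha ha1 ψ.continuous ψ.integrable
    fun x => SchwartzMap.norm_le_seminorm ℝ ψ x

/-! ### Duality between `L¹` and `L^∞` -/

theorem exists_schwartz_integral_norm_sub_lt {χ : Rd d → ℂ} (hχ : Integrable χ) {ε : ℝ}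
    (hε : 0 < ε) : ∃ ψ : 𝓢(Rd d, ℂ), ∫ x, ‖χ x - ψ x‖ < ε := by
  have hd := SchwartzMap.denseRange_toLpCLM (E := Rd d) (F := ℂ) (p := 1) (by simp)
    (μ := (volume : Measure (Rd d)))
  obtain ⟨ψ, hψ⟩ := hd.exists_dist_lt hχ.toL1 hε
  refine ⟨ψ, lt_of_eq_of_lt ?_ hψ⟩
  rw [dist_eq_norm, L1.norm_eq_integral_norm]
  refine integral_congr_ae ?_
  filter_upwards [Lp.coeFn_sub hχ.toL1 (SchwartzMap.toLpCLM ℝ ℂ 1 volume ψ), hχ.coeFn_toL1,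
    ψ.coeFn_toLp 1 volume] with x h1 h2 h3
  rw [h1, Pi.sub_apply, h2]
  simp only [SchwartzMap.toLpCLM_apply]
  rw [h3]

theorem norm_integral_mul_le {G χ : Rd d → ℂ} (hG : AEStronglyMeasurable G volume) {M : ℝ}
    (hM : ∀ᵐ x, ‖G x‖ ≤ M) (hχ : Integrable χ) :
    Integrable (fun x => χ x * G x) ∧ ‖∫ x, χ x * G x‖ ≤ M * ∫ x, ‖χ x‖ := by
  have hi := hχ.mul_bdd (c := M) hG hM
  refine ⟨hi, ?_⟩
  calc _ ≤ ∫ x, ‖χ x * G x‖ := norm_integral_le_integral_norm _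
    _ ≤ ∫ x, M * ‖χ x‖ := by
      refine integral_mono_ae hi.norm (hχ.norm.const_mul M) ?_
      filter_upwards [hM] with x hx
      rw [norm_mul, mul_comm]
      exact mul_le_mul_of_nonneg_right hx (norm_nonneg _)
    _ = _ := integral_const_mul _ _

theorem norm_integral_mul_le_of_schwartz {G : Rd d → ℂ} (hG : AEStronglyMeasurable G volume)
    {B M : ℝ} (hB : ∀ᵐ x, ‖G x‖ ≤ B)
    (h : ∀ ψ : 𝓢(Rd d, ℂ), ‖∫ x, ψ x * G x‖ ≤ M * ∫ x, ‖ψ x‖) (hM : 0 ≤ M)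
    {χ : Rd d → ℂ} (hχ : Integrable χ) : ‖∫ x, χ x * G x‖ ≤ M * ∫ x, ‖χ x‖ := by
  have hB' : ∀ᵐ x, ‖G x‖ ≤ |B| := hB.mono fun x hx => hx.trans (le_abs_self B)
  refine le_of_forall_pos_le_add fun ε hε => ?_
  -- The approximation error enters twice: with factor `|B|` through the pairing with `G`, and with
  -- factor `M` through the norm of `ψ`.
  have hδ : 0 < ε / (|B| + M + 1) := by positivity
  obtain ⟨ψ, hψ⟩ := exists_schwartz_integral_norm_sub_lt hχ hδ
  have hs : Integrable fun x => χ x - ψ x := hχ.sub ψ.integrable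
  obtain ⟨i1, b1⟩ := norm_integral_mul_le hG hB' hs
  obtain ⟨i2, -⟩ := norm_integral_mul_le hG hB' (ψ.integrable (μ := volume))
  have e : ∫ x, χ x * G x = (∫ x, (χ x - ψ x) * G x) + ∫ x, ψ x * G x := by
    rw [← integral_add i1 i2]; congr 1; ext x; ring
  have hn : ∫ x, ‖ψ x‖ ≤ (∫ x, ‖χ x‖) + ∫ x, ‖χ x - ψ x‖ := by
    rw [← integral_add hχ.norm hs.norm]
    refine integral_mono ψ.integrable.norm (hχ.norm.add hs.norm) fun x => ?_
    have := norm_sub_le (χ x) (χ x - ψ x)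
    simpa using this
  rw [lt_div_iff₀ (by positivity)] at hψ
  have h0 : 0 ≤ ∫ x, ‖χ x - ψ x‖ := integral_nonneg fun x => norm_nonneg _
  rw [e]
  refine (norm_add_le _ _).trans ?_
  have h3 := h ψ
  have h4 := mul_le_mul_of_nonneg_left hn hM
  nlinarith

/-- Testing against the conjugate phase of `G` on a set of finite measure compares the integrals of
`‖G‖` and of `M` over that set. -/
theorem ae_norm_le_of_schwartz {G : Rd d → ℂ} (hG : AEStronglyMeasurable G volume)
    {B M : ℝ} (hB : ∀ᵐ x, ‖G x‖ ≤ B)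
    (h : ∀ ψ : 𝓢(Rd d, ℂ), ‖∫ x, ψ x * G x‖ ≤ M * ∫ x, ‖ψ x‖) (hM : 0 ≤ M) :
    ∀ᵐ x, ‖G x‖ ≤ M := by
  have key : ∀ s, MeasurableSet s → volume s < ⊤ →
      ∫ x in s, ‖G x‖ ≤ ∫ _ in s, M := fun s hs hsv => by
    -- At zeros of `G` the inverse norm is `0` by convention, which is harmless since `χ` is only
    -- required to have norm at most `1`.
    set χ : Rd d → ℂ := s.indicator fun x => (starRingEnd ℂ) (G x) * (‖G x‖⁻¹ : ℝ) with hχ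
    have hle : ∀ x, ‖χ x‖ ≤ s.indicator (fun _ => (1 : ℝ)) x := fun x => by
      by_cases hx : x ∈ s
      · simp only [hχ, Set.indicator_of_mem hx, norm_mul, RCLike.norm_conj, Complex.norm_real,
          norm_inv, norm_norm]
        exact mul_inv_le_one
      · simp [hχ, hx]
    have hone : Integrable (s.indicator fun _ => (1 : ℝ)) (volume : Measure (Rd d)) :=
      (integrable_indicator_iff hs).2 (integrableOn_const hsv.ne (by simp))
    have hχi : Integrable χ := by
      refine hone.mono' (AEStronglyMeasurable.indicator ?_ hs) (Eventually.of_forall hle)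
      refine (Complex.continuous_conj.comp_aestronglyMeasurable hG).mul ?_
      exact Complex.continuous_ofReal.comp_aestronglyMeasurable
        (hG.norm.aemeasurable.inv.aestronglyMeasurable)
    have h1 := norm_integral_mul_le_of_schwartz hG hB h hM hχi
    have h2 : ∫ x, χ x * G x = ((∫ x in s, ‖G x‖ : ℝ) : ℂ) := by
      rw [← integral_indicator hs, ← integral_complex_ofReal]
      congr 1; ext x
      by_cases hx : x ∈ s
      · simp only [hχ, Set.indicator_of_mem hx]
        rcases eq_or_ne (G x) 0 with h0 | h0
        · simp [h0]
        · have : (‖G x‖ : ℂ) ≠ 0 := by simpa using h0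
          rw [mul_right_comm, mul_comm ((starRingEnd ℂ) (G x)), Complex.mul_conj,
            Complex.normSq_eq_norm_sq]
          push_cast
          field_simp
      · simp [hχ, hx]
    rw [h2, Complex.norm_real, Real.norm_of_nonneg (integral_nonneg fun _ => norm_nonneg _)] at h1
    have h3 : ∫ x, ‖χ x‖ ≤ ∫ x, s.indicator (fun _ => (1 : ℝ)) x :=
      integral_mono hχi.norm hone hle
    rw [integral_indicator hs] at h3
    calc _ ≤ M * ∫ x in s, (1 : ℝ) := h1.trans (mul_le_mul_of_nonneg_left h3 hM)
      _ = _ := by rw [← integral_const_mul]; simp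
  -- The constant `M` need not be integrable on the whole space, so the comparison is localized to
  -- balls.
  have hn : ∀ n : ℕ, ∀ᵐ x, x ∈ Metric.ball (0 : Rd d) n → ‖G x‖ ≤ M := fun n => by
    rw [← ae_restrict_iff' Metric.isOpen_ball.measurableSet]
    have hc : Integrable (fun _ : Rd d => B) (volume.restrict (Metric.ball (0 : Rd d) n)) :=
      integrableOn_const measure_ball_lt_top.ne (by simp)
    have hc' : Integrable (fun _ : Rd d => M) (volume.restrict (Metric.ball (0 : Rd d) n)) :=
      integrableOn_const measure_ball_lt_top.ne (by simp)
    refine ae_le_of_forall_setIntegral_le (f := fun x => ‖G x‖) (g := fun _ => M)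
      (hc.mono' hG.norm.restrict ?_) hc' fun s hs _ => ?_
    · exact ae_restrict_of_ae (hB.mono fun x hx => by simpa using hx)
    · rw [Measure.restrict_restrict hs]
      exact key _ (hs.inter Metric.isOpen_ball.measurableSet)
        ((measure_mono Set.inter_subset_right).trans_lt measure_ball_lt_top)
  filter_upwards [ae_all_iff.2 hn] with x hx
  obtain ⟨n, hn⟩ := exists_nat_gt ‖x‖
  exact hx n (by simpa using hn)

/-! ### Essentially bounded functions as distributions -/

theorem toTemperedDistribution_injective {G H : Lp ℂ ⊤ (volume : Measure (Rd d))}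
    (h : Lp.toTemperedDistribution G = Lp.toTemperedDistribution H) : G = H :=
  LinearMap.ker_eq_bot.1 (Lp.ker_toTemperedDistributionCLM_eq_bot (E := Rd d) (F := ℂ)
    (μ := volume) (p := ⊤)) h

theorem linftyNorm_toTemperedDistribution (G : Lp ℂ ⊤ (volume : Measure (Rd d))) :
    linftyNorm (Lp.toTemperedDistribution G) = ‖G‖ₑ :=
  le_antisymm (iInf_le_of_le G (iInf_le_of_le rfl le_rfl))
    (le_iInf₂ fun H hH => by rw [toTemperedDistribution_injective hH])

theorem linftyRep_spec {f : Dist d} (hf : linftyNorm f < ⊤) :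
    Lp.toTemperedDistribution (linftyRep f) = f ∧ ‖linftyRep f‖ₑ = linftyNorm f := by
  have h : ∃ g : Lp ℂ ⊤ (volume : Measure (Rd d)), Lp.toTemperedDistribution g = f := by
    by_contra hn
    push Not at hn
    refine hf.ne (iInf₂_eq_top.2 fun g hg => absurd hg (hn g))
  have h1 : Lp.toTemperedDistribution (linftyRep f) = f := by
    rw [linftyRep, dif_pos h]; exact h.choose_spec
  exact ⟨h1, by rw [← linftyNorm_toTemperedDistribution, h1]⟩

theorem linftyRep_toTemperedDistribution (G : Lp ℂ ⊤ (volume : Measure (Rd d))) :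
    linftyRep (Lp.toTemperedDistribution G) = G :=
  toTemperedDistribution_injective (linftyRep_spec (by
    rw [linftyNorm_toTemperedDistribution]; exact enorm_lt_top)).1

theorem ae_norm_linftyRep_le {f : Dist d} {M : ℝ} (hM : 0 ≤ M)
    (hf : linftyNorm f ≤ ENNReal.ofReal M) : ∀ᵐ x, ‖linftyRep f x‖ ≤ M := by
  have h := linftyRep_spec (hf.trans_lt ENNReal.ofReal_lt_top)
  have h1 : eLpNorm (linftyRep f) ⊤ volume ≤ ENNReal.ofReal M := by
    rw [← Lp.enorm_def, h.2]; exact hf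
  have h2 := ae_le_eLpNormEssSup (f := linftyRep f) (μ := volume)
  rw [eLpNorm_exponent_top] at h1
  filter_upwards [h2] with x hx
  rw [← ofReal_norm] at hx
  exact (ENNReal.ofReal_le_ofReal_iff hM).1 (hx.trans h1)

theorem apply_eq_integral_linftyRep {f : Dist d} (hf : linftyNorm f < ⊤) (ψ : 𝓢(Rd d, ℂ)) :
    f ψ = ∫ x, ψ x * linftyRep f x := by
  conv_lhs => rw [← (linftyRep_spec hf).1]
  simp

theorem norm_apply_le_of_linftyNorm_le {f : Dist d} {M : ℝ} (hM : 0 ≤ M)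
    (hf : linftyNorm f ≤ ENNReal.ofReal M) (ψ : 𝓢(Rd d, ℂ)) : ‖f ψ‖ ≤ M * ∫ x, ‖ψ x‖ := by
  rw [apply_eq_integral_linftyRep (hf.trans_lt ENNReal.ofReal_lt_top)]
  exact (norm_integral_mul_le (Lp.aestronglyMeasurable _) (ae_norm_linftyRep_le hM hf)
    ψ.integrable).2

/-- Finiteness is assumed so that a representing function is at hand; the test function bound then
only sharpens its norm. -/
theorem linftyNorm_le_of_norm_apply_le {f : Dist d} {M : ℝ} (hM : 0 ≤ M) (hf : linftyNorm f < ⊤)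
    (h : ∀ ψ : 𝓢(Rd d, ℂ), ‖f ψ‖ ≤ M * ∫ x, ‖ψ x‖) : linftyNorm f ≤ ENNReal.ofReal M := by
  have h0 := ae_norm_linftyRep_le (f := f) (M := (linftyNorm f).toReal) (by positivity)
    (by rw [ENNReal.ofReal_toReal hf.ne])
  have h1 := ae_norm_le_of_schwartz (Lp.aestronglyMeasurable (linftyRep f)) h0
    (fun ψ => by rw [← apply_eq_integral_linftyRep hf]; exact h ψ) hM
  rw [← (linftyRep_spec hf).2, Lp.enorm_def, eLpNorm_exponent_top]
  exact eLpNormEssSup_le_of_ae_bound h1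

theorem ofFun_apply {g : Rd d → ℂ} (hg : MemLp g ⊤ volume) (ψ : 𝓢(Rd d, ℂ)) :
    ofFun g ψ = ∫ x, ψ x * g x := by
  rw [ofFun, dif_pos hg, Lp.toTemperedDistribution_apply]
  refine integral_congr_ae ?_
  filter_upwards [hg.coeFn_toLp] with x hx
  rw [hx, smul_eq_mul]

theorem linftyRep_ofFun {g : Rd d → ℂ} (hg : MemLp g ⊤ volume) :
    linftyRep (ofFun g) =ᵐ[volume] g := by
  rw [ofFun, dif_pos hg, linftyRep_toTemperedDistribution]
  exact hg.coeFn_toLp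

theorem memLp_top_of_continuous {g : Rd d → ℂ} (hg : Continuous g) {M : ℝ}
    (hM : ∀ x, ‖g x‖ ≤ M) : MemLp g ⊤ (volume : Measure (Rd d)) :=
  memLp_top_of_bound hg.aestronglyMeasurable M (Eventually.of_forall hM)

/-! ### Besov norms -/

theorem linftyNorm_block_le {φ : DyadicCutoff d} {γ N : ℝ} {f : Dist d}
    (h : besovNorm φ γ f ≤ ENNReal.ofReal N) (j : ℕ) :
    linftyNorm (block φ j f) ≤ ENNReal.ofReal (N * (2 : ℝ) ^ (-(γ * j))) := by
  have h1 := (le_iSup (fun j : ℕ => ENNReal.ofReal ((2 : ℝ) ^ (γ * (j : ℝ))) *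
    linftyNorm (block φ j f)) j).trans h
  have hp : (0 : ℝ) < (2 : ℝ) ^ (γ * (j : ℝ)) := by positivity
  rw [Real.rpow_neg (by norm_num), ← div_eq_mul_inv, ENNReal.ofReal_div_of_pos hp,
    ENNReal.le_div_iff_mul_le (Or.inl (by simpa using hp)) (Or.inl ENNReal.ofReal_ne_top), mul_comm]
  exact h1

theorem besovNorm_le {φ : DyadicCutoff d} {γ N : ℝ} {f : Dist d}
    (h : ∀ j, linftyNorm (block φ j f) ≤ ENNReal.ofReal (N * (2 : ℝ) ^ (-(γ * j)))) :
    besovNorm φ γ f ≤ ENNReal.ofReal N := by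
  refine iSup_le fun j => (mul_le_mul_right (h j) _).trans ?_
  rw [← ENNReal.ofReal_mul (by positivity), mul_left_comm, ← Real.rpow_add (by norm_num)]
  simp

theorem linftyNorm_block_lt_top {φ : DyadicCutoff d} {γ : ℝ} {f : Dist d}
    (h : besovNorm φ γ f < ⊤) (j : ℕ) : linftyNorm (block φ j f) < ⊤ :=
  (linftyNorm_block_le (N := (besovNorm φ γ f).toReal) (by rw [ENNReal.ofReal_toReal h.ne])
    j).trans_lt ENNReal.ofReal_lt_top

/-! ### Cutoffs as Schwartz functions -/

/-- The dilate `ξ ↦ m (c ξ)` of a Schwartz function. -/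
def dilate (m : 𝓢(Rd d, ℂ)) (c : ℝ) (hc : c ≠ 0) : 𝓢(Rd d, ℂ) :=
  SchwartzMap.compCLMOfContinuousLinearEquiv ℂ
    (ContinuousLinearEquiv.smulLeft (Units.mk0 c hc) : Rd d ≃L[ℝ] Rd d) m

@[simp] theorem dilate_apply (m : 𝓢(Rd d, ℂ)) (c : ℝ) (hc : c ≠ 0) (ξ : Rd d) :
    dilate m c hc ξ = m (c • ξ) := rfl

/-- The cutoff `φ₀` as a Schwartz function. -/
def DyadicCutoff.base (φ : DyadicCutoff d) : 𝓢(Rd d, ℂ) :=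
  HasCompactSupport.toSchwartzMap (f := fun ξ => ((φ.toFun ξ : ℝ) : ℂ))
    (HasCompactSupport.intro (isCompact_closedBall (0 : Rd d) (3 / 2)) fun ξ hξ => by
      rw [φ.eq_zero ξ (by simpa using (not_le.1 (by simpa using hξ)).le)]; simp)
    (Complex.ofRealCLM.contDiff.comp φ.smooth)

@[simp] theorem DyadicCutoff.base_apply (φ : DyadicCutoff d) (ξ : Rd d) :
    φ.base ξ = ((φ.toFun ξ : ℝ) : ℂ) := rfl

/-- The annular cutoff `φ₀ - φ₀ (2 ·)` as a Schwartz function. -/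
def DyadicCutoff.annulus (φ : DyadicCutoff d) : 𝓢(Rd d, ℂ) :=
  φ.base - dilate φ.base 2 two_ne_zero

/-- The function of which `φ_j` is the dilate with factor `2^{-j}`. -/
def DyadicCutoff.profile (φ : DyadicCutoff d) : ℕ → 𝓢(Rd d, ℂ)
  | 0 => φ.base
  | _ + 1 => φ.annulus

theorem DyadicCutoff.part_eq (φ : DyadicCutoff d) (j : ℕ) :
    (fun ξ => ((φ.part j ξ : ℝ) : ℂ)) = fun ξ => φ.profile j (((2 : ℝ) ^ j)⁻¹ • ξ) := by
  ext ξ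
  cases j with
  | zero => simp [DyadicCutoff.part, DyadicCutoff.profile]
  | succ j =>
    have : (2 : ℝ) * ((2 : ℝ) ^ (j + 1))⁻¹ = ((2 : ℝ) ^ j)⁻¹ := by rw [pow_succ]; field_simp
    simp [DyadicCutoff.part, DyadicCutoff.profile, DyadicCutoff.annulus, smul_smul, this]

theorem DyadicCutoff.hasTemperateGrowth_part (φ : DyadicCutoff d) (j : ℕ) :
    Function.HasTemperateGrowth fun ξ => ((φ.part j ξ : ℝ) : ℂ) := by
  rw [φ.part_eq]; exact hasTemperateGrowth_dilate _ _

theorem DyadicCutoff.sum_part (φ : DyadicCutoff d) (n : ℕ) (ξ : Rd d) :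
    ∑ j ∈ Finset.range (n + 1), φ.part j ξ = φ.toFun (((2 : ℝ) ^ n)⁻¹ • ξ) := by
  induction n with
  | zero => simp [DyadicCutoff.part]
  | succ n ih => rw [Finset.sum_range_succ, ih]; simp [DyadicCutoff.part]

/-- The partition of unity telescopes, so `n + 1` blocks together form a single multiplier, the
dilate of `φ₀` at scale `2^n`. -/
theorem partialSum_succ (φ : DyadicCutoff d) (n : ℕ) (f : Dist d) :
    partialSum φ (n + 1) f = TemperedDistribution.fourierMultiplierCLM ℂ
      (fun ξ => φ.base (((2 : ℝ) ^ n)⁻¹ • ξ)) f := by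
  have : (fun ξ => φ.base (((2 : ℝ) ^ n)⁻¹ • ξ))
      = fun ξ => ∑ j ∈ Finset.range (n + 1), ((φ.part j ξ : ℝ) : ℂ) := by
    ext ξ
    rw [DyadicCutoff.base_apply, ← φ.sum_part]; push_cast; rfl
  rw [this, TemperedDistribution.fourierMultiplierCLM_sum ℂ
    fun j _ => φ.hasTemperateGrowth_part j]
  simp [partialSum, block]

/-- The support of `φ_j` is contained in the ball of radius `(3/2) 2^j`. -/
theorem DyadicCutoff.norm_le_of_part_ne_zero (φ : DyadicCutoff d) {j : ℕ} {ξ : Rd d}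
    (h : φ.part j ξ ≠ 0) : ‖((2 : ℝ) ^ j)⁻¹ • ξ‖ < 3 / 2 := by
  by_contra hn
  push Not at hn
  cases j with
  | zero => exact h (φ.eq_zero _ (by simpa using hn))
  | succ j =>
    refine h ?_
    have h2 : 3 / 2 ≤ ‖((2 : ℝ) ^ j)⁻¹ • ξ‖ := by
      have e : ((2 : ℝ) ^ j)⁻¹ • ξ = (2 : ℝ) • ((2 : ℝ) ^ (j + 1))⁻¹ • ξ := by
        rw [smul_smul, pow_succ]; congr 1; field_simp
      rw [e, norm_smul]; norm_num; linarith [norm_nonneg (((2 : ℝ) ^ (j + 1))⁻¹ • ξ)]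
    simp [DyadicCutoff.part, φ.eq_zero _ hn, φ.eq_zero _ h2]

theorem DyadicCutoff.le_norm_of_annulus_ne_zero (φ : DyadicCutoff d) {ξ : Rd d}
    (h : φ.annulus ξ ≠ 0) : 1 / 2 < ‖ξ‖ := by
  by_contra hn
  push Not at hn
  refine h ?_
  have h2 : ‖(2 : ℝ) • ξ‖ ≤ 1 := by rw [norm_smul]; norm_num; linarith
  simp [DyadicCutoff.annulus, φ.eq_one ξ (by linarith), φ.eq_one _ h2]

theorem DyadicCutoff.le_norm_of_part_ne_zero (φ : DyadicCutoff d) {j : ℕ} {ξ : Rd d}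
    (h : φ.part (j + 1) ξ ≠ 0) : 1 / 2 < ‖((2 : ℝ) ^ (j + 1))⁻¹ • ξ‖ := by
  refine φ.le_norm_of_annulus_ne_zero fun h0 => h ?_
  have := congrFun (φ.part_eq (j + 1)) ξ
  simp only [DyadicCutoff.profile, h0] at this
  exact_mod_cast this

/-- A cutoff equal to `1` on the support of `φ₀`. -/
def DyadicCutoff.fat (φ : DyadicCutoff d) : 𝓢(Rd d, ℂ) := dilate φ.base 2⁻¹ (by norm_num)

/-- A cutoff that vanishes at the origin and is equal to `1` on the support of `φ₀ - φ₀ (2 ·)`. -/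
def DyadicCutoff.fatAnnulus (φ : DyadicCutoff d) : 𝓢(Rd d, ℂ) :=
  φ.fat - dilate φ.base 4 (by norm_num)

theorem DyadicCutoff.part_mul_fat (φ : DyadicCutoff d) (j : ℕ) (ξ : Rd d) :
    ((φ.part j ξ : ℝ) : ℂ) * φ.fat (((2 : ℝ) ^ j)⁻¹ • ξ) = ((φ.part j ξ : ℝ) : ℂ) := by
  by_cases h : φ.part j ξ = 0
  · simp [h]
  · have h1 := φ.norm_le_of_part_ne_zero h
    have h2 : ‖(2 : ℝ)⁻¹ • ((2 : ℝ) ^ j)⁻¹ • ξ‖ ≤ 1 := by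
      rw [norm_smul]; norm_num at h1 ⊢; linarith
    simp [DyadicCutoff.fat, φ.eq_one _ h2]

theorem DyadicCutoff.part_mul_fatAnnulus (φ : DyadicCutoff d) (j : ℕ) (ξ : Rd d) :
    ((φ.part (j + 1) ξ : ℝ) : ℂ) * φ.fatAnnulus (((2 : ℝ) ^ (j + 1))⁻¹ • ξ)
      = ((φ.part (j + 1) ξ : ℝ) : ℂ) := by
  by_cases h : φ.part (j + 1) ξ = 0
  · simp [h]
  · have h1 := φ.le_norm_of_part_ne_zero h
    -- The support lies outside radius `1/2`, and `4 * (1/2) = 2` exceeds `3/2`, so the subtracted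
    -- cutoff is zero there.
    have h2 : 3 / 2 ≤ ‖(4 : ℝ) • ((2 : ℝ) ^ (j + 1))⁻¹ • ξ‖ := by
      rw [norm_smul]; norm_num at h1 ⊢; linarith
    have h3 := φ.part_mul_fat (j + 1) ξ
    simp only [DyadicCutoff.fatAnnulus, sub_apply, mul_sub, h3, dilate_apply,
      DyadicCutoff.base_apply, φ.eq_zero _ h2]
    simp

theorem DyadicCutoff.fatAnnulus_zero (φ : DyadicCutoff d) : φ.fatAnnulus 0 = 0 := by
  simp [DyadicCutoff.fatAnnulus, DyadicCutoff.fat]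

/-! ### Low frequency parts of bounded functions -/

/-- The average `∫ K(y) f (z + l y) dy`. -/
def average (K : 𝓢(Rd d, ℂ)) (l : ℝ) (f : Rd d → ℂ) (z : Rd d) : ℂ := ∫ y, K y * f (z + l • y)

theorem integrable_average (K : 𝓢(Rd d, ℂ)) (l : ℝ) {f : Rd d → ℂ} (hf : Continuous f) {A : ℝ}
    (hA : ∀ x, ‖f x‖ ≤ A) (z : Rd d) : Integrable fun y => K y * f (z + l • y) :=
  (K.integrable (μ := volume)).mul_bdd (c := A)
    (by fun_prop : Continuous fun y : Rd d => f (z + l • y)).aestronglyMeasurable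
    (Eventually.of_forall fun y => hA _)

theorem continuous_average (K : 𝓢(Rd d, ℂ)) (l : ℝ) {f : Rd d → ℂ} (hf : Continuous f) {A : ℝ}
    (hA : ∀ x, ‖f x‖ ≤ A) : Continuous (average K l f) := by
  have := K.continuous
  refine continuous_of_dominated (bound := fun y => ‖K y‖ * A)
    (fun z => (integrable_average K l hf hA z).aestronglyMeasurable)
    (fun z => Eventually.of_forall fun y => ?_) (K.integrable.norm.mul_const _)
    (Eventually.of_forall fun y => by fun_prop)
  rw [norm_mul]; exact mul_le_mul_of_nonneg_left (hA _) (norm_nonneg _)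

theorem norm_average_le (K : 𝓢(Rd d, ℂ)) (l : ℝ) {f : Rd d → ℂ} {A : ℝ} (hA : ∀ x, ‖f x‖ ≤ A)
    (z : Rd d) : ‖average K l f z‖ ≤ w11 K * A := by
  refine (norm_integral_le_of_norm_le (g := fun y => ‖K y‖ * A) (K.integrable.norm.mul_const _)
    (Eventually.of_forall fun y => ?_)).trans ?_
  · rw [norm_mul]; exact mul_le_mul_of_nonneg_left (hA _) (norm_nonneg _)
  · rw [integral_mul_const]
    exact mul_le_mul_of_nonneg_right (integral_norm_le_w11 K) ((norm_nonneg _).trans (hA 0))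

/-- Averaging commutes with translation. The Hölder constant is thus controlled uniformly in `l`, as
the dominated convergence for the product requires. -/
theorem norm_average_sub_le (K : 𝓢(Rd d, ℂ)) (l : ℝ) {f : Rd d → ℂ} (hf : Continuous f) {A : ℝ}
    (hA : ∀ x, ‖f x‖ ≤ A)
    {a : ℝ} (hH : ∀ x h, ‖f (x + h) - f x‖ ≤ A * ‖h‖ ^ a) (z h : Rd d) :
    ‖average K l f (z + h) - average K l f z‖ ≤ w11 K * A * ‖h‖ ^ a := by
  have hA0 : 0 ≤ A := (norm_nonneg _).trans (hA 0)
  rw [average, average, ← integral_sub (integrable_average K l hf hA _)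
    (integrable_average K l hf hA _)]
  refine (norm_integral_le_of_norm_le (g := fun y => ‖K y‖ * (A * ‖h‖ ^ a))
    (K.integrable.norm.mul_const _) (Eventually.of_forall fun y => ?_)).trans ?_
  · rw [← mul_sub, norm_mul, add_right_comm]
    exact mul_le_mul_of_nonneg_left (hH _ _) (norm_nonneg _)
  · rw [integral_mul_const, mul_assoc]
    exact mul_le_mul_of_nonneg_right (integral_norm_le_w11 K) (by positivity)

theorem tendsto_average (K : 𝓢(Rd d, ℂ)) {f : Rd d → ℂ} (hf : Continuous f) {A : ℝ}
    (hA : ∀ x, ‖f x‖ ≤ A)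
    {l : ℕ → ℝ} (hl : Tendsto l atTop (𝓝 0)) (hK : ∫ y, K y = 1) (z : Rd d) :
    Tendsto (fun n => average K (l n) f z) atTop (𝓝 (f z)) := by
  have h : Tendsto (fun n => average K (l n) f z) atTop (𝓝 (∫ y, K y * f z)) := by
    refine tendsto_integral_of_dominated_convergence (fun y => ‖K y‖ * A)
      (fun n => (integrable_average K (l n) hf hA z).aestronglyMeasurable)
      (K.integrable.norm.mul_const _) (fun n => Eventually.of_forall fun y => ?_)
      (Eventually.of_forall fun y => ?_)
    · rw [norm_mul]; exact mul_le_mul_of_nonneg_left (hA _) (norm_nonneg _)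
    · refine Tendsto.const_mul _ (hf.continuousAt.tendsto.comp ?_)
      simpa using (tendsto_const_nhds (x := z)).add (hl.smul_const y)
  simpa [integral_mul_const, hK] using h

/-- Fubini: `average` is the transpose of `dilConv`, whence the opposite sign in its argument. -/
theorem integral_dilConv_mul (K : 𝓢(Rd d, ℂ)) (l : ℝ) {f : Rd d → ℂ} (hf : Continuous f) {A : ℝ}
    (hA : ∀ x, ‖f x‖ ≤ A)
    (ψ : 𝓢(Rd d, ℂ)) :
    ∫ x, dilConv K l ψ x * f x = ∫ x, ψ x * average K l f x := by
  have hKc := K.continuous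
  have hψ := ψ.continuous
  have hm : Continuous (Function.uncurry fun (y x : Rd d) => K y * ψ (x - l • y) * f x) := by
    simp only [Function.uncurry_def]; fun_prop
  have hi : Integrable (Function.uncurry fun (y x : Rd d) => K y * ψ (x - l • y) * f x)
      (volume.prod volume) := by
    have h1 : ∀ y, Integrable fun x => K y * ψ (x - l • y) * f x := fun y =>
      (((ψ.integrable (μ := volume)).comp_sub_right (l • y)).const_mul (K y)).mul_bdd (c := A)
        hf.aestronglyMeasurable (Eventually.of_forall hA)
    refine (integrable_prod_iff hm.aestronglyMeasurable).2 ⟨Eventually.of_forall h1, ?_⟩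
    refine ((K.integrable (μ := volume)).norm.mul_const ((∫ x, ‖ψ x‖) * A)).mono'
      hm.aestronglyMeasurable.norm.integral_prod_right' (Eventually.of_forall fun y => ?_)
    rw [Real.norm_of_nonneg (integral_nonneg fun _ => norm_nonneg _)]
    have h2 : Integrable fun x => ‖K y‖ * (‖ψ (x - l • y)‖ * A) :=
      (((ψ.integrable (μ := volume)).comp_sub_right (l • y)).norm.mul_const _).const_mul _
    refine (integral_mono (h1 y).norm h2 fun x => ?_).trans (le_of_eq ?_)
    · simp only [norm_mul]
      rw [mul_assoc]
      gcongr
      exact hA x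
    · rw [integral_const_mul, integral_mul_const, integral_sub_right_eq_self (fun x => ‖ψ x‖)]
  calc ∫ x, dilConv K l ψ x * f x = ∫ x, ∫ y, K y * ψ (x - l • y) * f x := by
        simp only [dilConv, integral_mul_const]
    _ = ∫ y, ∫ x, K y * ψ (x - l • y) * f x := (integral_integral_swap hi).symm
    _ = ∫ y, ∫ x, K y * ψ x * f (x + l • y) := by
        congr 1; ext y
        rw [← integral_add_right_eq_self _ (l • y)]; simp
    _ = ∫ x, ∫ y, K y * ψ x * f (x + l • y) := by
        refine integral_integral_swap (f := fun (y x : Rd d) => K y * ψ x * f (x + l • y)) ?_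
        refine ((K.integrable (μ := volume)).mul_prod (ψ.integrable (μ := volume))).mul_bdd (c := A)
          ?_ (Eventually.of_forall fun p => hA _)
        exact (by fun_prop : Continuous fun p : Rd d × Rd d =>
          f (p.2 + l • p.1)).aestronglyMeasurable
    _ = ∫ x, ψ x * average K l f x := by
        congr 1; ext x
        rw [average, ← integral_const_mul]
        congr 1; ext y; ring

/-- The kernel of the low frequency projection. -/
def DyadicCutoff.kernel (φ : DyadicCutoff d) : 𝓢(Rd d, ℂ) := FourierTransform.fourier φ.base

theorem DyadicCutoff.integral_kernel (φ : DyadicCutoff d) : ∫ y, φ.kernel y = 1 := by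
  rw [DyadicCutoff.kernel, integral_fourier_eq]
  simp [φ.eq_one 0]

theorem partialSum_ofFun (φ : DyadicCutoff d) (n : ℕ) {f : Rd d → ℂ} (hf : Continuous f) {A : ℝ}
    (hA : ∀ x, ‖f x‖ ≤ A) :
    partialSum φ (n + 1) (ofFun f) = ofFun (average φ.kernel (((2 : ℝ) ^ n)⁻¹) f) := by
  ext ψ
  rw [partialSum_succ, fourierMultiplier_apply, ofFun_apply (memLp_top_of_continuous hf hA),
    ofFun_apply (memLp_top_of_continuous (continuous_average _ _ hf hA)
      (norm_average_le _ _ hA)), ← integral_dilConv_mul _ _ hf hA]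
  congr 1; ext x
  rw [adjMult_dilate_apply]; rfl

theorem tendsto_inv_two_pow : Tendsto (fun n : ℕ => ((2 : ℝ) ^ n)⁻¹) atTop (𝓝 0) :=
  tendsto_inv_atTop_zero.comp (tendsto_pow_atTop_atTop_of_one_lt one_lt_two)

theorem tendsto_partialSum_ofFun (φ : DyadicCutoff d) {f : Rd d → ℂ} (hf : Continuous f) {A : ℝ}
    (hA : ∀ x, ‖f x‖ ≤ A) (ψ : 𝓢(Rd d, ℂ)) :
    Tendsto (fun n => partialSum φ (n + 1) (ofFun f) ψ) atTop (𝓝 (ofFun f ψ)) := by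
  have hm : ∀ n : ℕ, MemLp (average φ.kernel (((2 : ℝ) ^ n)⁻¹) f) ⊤ volume := fun n =>
    memLp_top_of_continuous (continuous_average _ _ hf hA) (norm_average_le _ _ hA)
  simp only [partialSum_ofFun φ _ hf hA, ofFun_apply (hm _),
    ofFun_apply (memLp_top_of_continuous hf hA)]
  refine tendsto_integral_of_dominated_convergence (fun x => ‖ψ x‖ * (w11 φ.kernel * A))
    (fun n => (ψ.continuous.mul (continuous_average _ _ hf hA)).aestronglyMeasurable)
    (ψ.integrable.norm.mul_const _) (fun n => Eventually.of_forall fun x => ?_)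
    (Eventually.of_forall fun x => ?_)
  · rw [norm_mul]
    exact mul_le_mul_of_nonneg_left (norm_average_le _ _ hA x) (norm_nonneg _)
  · exact (tendsto_average φ.kernel hf hA tendsto_inv_two_pow φ.integral_kernel x).const_mul _

/-! ### The product of a Hölder function and a distribution -/

/-- A multiplier equal to `1` on the support of `φ_j` reproduces the block. -/
theorem fourierMultiplier_block (φ : DyadicCutoff d) (j : ℕ) (g : Dist d) (m : 𝓢(Rd d, ℂ)) {l : ℝ}
    (h : ∀ ξ, ((φ.part j ξ : ℝ) : ℂ) * m (l • ξ) = ((φ.part j ξ : ℝ) : ℂ)) :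
    TemperedDistribution.fourierMultiplierCLM ℂ (fun ξ => m (l • ξ)) (block φ j g)
      = block φ j g := by
  rw [block, TemperedDistribution.fourierMultiplierCLM_fourierMultiplierCLM_apply
    (φ.hasTemperateGrowth_part j) (hasTemperateGrowth_dilate m l)]
  congr 1
  congr 1
  funext ξ
  exact h ξ

/-- If `G` is invariant under the Fourier multiplier with symbol `m (l ξ)`, then pairing with `G`
only sees this part of the other function. -/
theorem norm_integral_mul_le_dilConv {D : Dist d} {B : ℝ} (hB : 0 ≤ B)
    (hD : linftyNorm D ≤ ENNReal.ofReal B) (m : 𝓢(Rd d, ℂ)) {l : ℝ}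
    (h : TemperedDistribution.fourierMultiplierCLM ℂ (fun ξ => m (l • ξ)) D = D)
    {χ : Rd d → ℂ} (hχ : Continuous χ) (hi : Integrable χ) {M : ℝ} (hM : ∀ x, ‖χ x‖ ≤ M) :
    ‖∫ x, χ x * linftyRep D x‖ ≤ B * ∫ x, ‖dilConv (FourierTransform.fourier m) l χ x‖ := by
  set K : 𝓢(Rd d, ℂ) := FourierTransform.fourier m
  have hG := Lp.aestronglyMeasurable (linftyRep D)
  have hGB := ae_norm_linftyRep_le hB hD
  have hS : ∀ ψ : 𝓢(Rd d, ℂ), ‖∫ x, ψ x * linftyRep D x‖ ≤ B * ∫ x, ‖dilConv K l ψ x‖ := by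
    intro ψ
    rw [← apply_eq_integral_linftyRep (hD.trans_lt ENNReal.ofReal_lt_top), ← h,
      fourierMultiplier_apply]
    have := norm_apply_le_of_linftyNorm_le hB hD (adjMult (fun ξ => m (l • ξ)) ψ)
    simpa only [adjMult_dilate_apply] using this
  have hw := w11_nonneg K
  refine le_of_forall_pos_le_add fun ε hε => ?_
  -- The difference `χ - ψ` costs `B` when paired directly and `B * w11 K` when convolved first.
  obtain ⟨ψ, hψ⟩ := exists_schwartz_integral_norm_sub_lt hi
    (show 0 < ε / (B + B * w11 K + 1) by positivity)
  have hs : Integrable fun x => χ x - ψ x := hi.sub ψ.integrable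
  have hsc : Continuous fun x => χ x - ψ x := hχ.sub ψ.continuous
  obtain ⟨i1, b1⟩ := norm_integral_mul_le hG hGB hs
  obtain ⟨i2, -⟩ := norm_integral_mul_le hG hGB (ψ.integrable (μ := volume))
  have e : ∫ x, χ x * linftyRep D x
      = (∫ x, (χ x - ψ x) * linftyRep D x) + ∫ x, ψ x * linftyRep D x := by
    rw [← integral_add i1 i2]; congr 1; ext x; ring
  obtain ⟨j1, c1⟩ := dilConv_norm_le K l hχ hi
  obtain ⟨j2, c2⟩ := dilConv_norm_le K l hsc hs
  have hae : ∀ᵐ x, dilConv K l ψ x = dilConv K l χ x - dilConv K l (fun x => χ x - ψ x) x := by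
    refine Eventually.of_forall fun x => ?_
    have hx : Integrable fun y => K y * χ (x - l • y) :=
      (K.integrable (μ := volume)).mul_bdd (c := M)
        (by fun_prop : Continuous fun y : Rd d => χ (x - l • y)).aestronglyMeasurable
        (Eventually.of_forall fun y => hM _)
    have hψi : Integrable fun y => K y * ψ (x - l • y) :=
      (K.integrable (μ := volume)).mul_bdd (c := SchwartzMap.seminorm ℝ 0 0 ψ)
        (by have := ψ.continuous; fun_prop :
          Continuous fun y : Rd d => ψ (x - l • y)).aestronglyMeasurable
        (Eventually.of_forall fun y => SchwartzMap.norm_le_seminorm ℝ ψ _)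
    simp only [dilConv, mul_sub]
    rw [integral_sub hx hψi]
    ring
  have c3 : ∫ x, ‖dilConv K l ψ x‖
      ≤ (∫ x, ‖dilConv K l χ x‖) + ∫ x, ‖dilConv K l (fun x => χ x - ψ x) x‖ := by
    rw [← integral_add j1.norm j2.norm]
    refine integral_mono_ae (dilConv_norm_le K l ψ.continuous ψ.integrable).1.norm
      (j1.norm.add j2.norm) ?_
    filter_upwards [hae] with x hx
    rw [hx]; exact norm_sub_le _ _
  rw [lt_div_iff₀ (by positivity)] at hψ
  have h0 : 0 ≤ ∫ x, ‖χ x - ψ x‖ := integral_nonneg fun x => norm_nonneg _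
  have c4 := mul_le_mul_of_nonneg_right (integral_norm_le_w11 K) h0
  have c5 := hS ψ
  have c6 := mul_le_mul_of_nonneg_left (c3.trans (add_le_add le_rfl (c2.trans c4))) hB
  rw [e]
  refine (norm_add_le _ _).trans ?_
  nlinarith

/-- The decay of the pairing of the blocks of a distribution with a Hölder function. -/
theorem norm_integral_mul_block_le (φ : DyadicCutoff d) {a : ℝ} (ha : 0 ≤ a) (ha1 : a ≤ 1) :
    ∃ C : ℝ, 0 ≤ C ∧ ∀ (g : Dist d) (j : ℕ) (B : ℝ), 0 ≤ B →
      linftyNorm (block φ j g) ≤ ENNReal.ofReal B → ∀ (χ : Rd d → ℂ) (M P : ℝ), Continuous χ →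
      Integrable χ → (∀ x, ‖χ x‖ ≤ M) → ∫ x, ‖χ x‖ ≤ P → L1Holder a χ P →
      ‖∫ x, χ x * linftyRep (block φ j g) x‖ ≤ C * B * P * (2 : ℝ) ^ (-(a * j)) := by
  set K : 𝓢(Rd d, ℂ) := FourierTransform.fourier φ.fatAnnulus with hK
  have hI : 0 ≤ ∫ y, ‖K y‖ * ‖y‖ ^ a := integral_nonneg fun y => by positivity
  refine ⟨1 + ∫ y, ‖K y‖ * ‖y‖ ^ a, by positivity, fun g j B hB hg χ M P hχ hi hM hP hH => ?_⟩
  have hP0 : 0 ≤ P := (integral_nonneg fun x => norm_nonneg _).trans hP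
  cases j with
  -- The zeroth block has no cancellation, but no decay is asked of it.
  | zero =>
    have := (norm_integral_mul_le (Lp.aestronglyMeasurable _) (ae_norm_linftyRep_le hB hg) hi).2
    simp only [Nat.cast_zero, mul_zero, neg_zero, Real.rpow_zero, mul_one]
    have h2 := mul_le_mul_of_nonneg_left hP hB
    nlinarith [mul_nonneg hI (mul_nonneg hB hP0)]
  | succ j =>
    -- The reproducing symbol vanishes at the origin, so its kernel has mean zero and converts the
    -- Hölder constant of `χ` into `2^{-aj}`.
    have h0 : ∫ y, K y = 0 := by rw [hK, integral_fourier_eq, φ.fatAnnulus_zero]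
    have h1 := norm_integral_mul_le_dilConv hB hg φ.fatAnnulus
      (fourierMultiplier_block φ (j + 1) g φ.fatAnnulus (φ.part_mul_fatAnnulus j)) hχ hi hM
    have h2 := dilConv_norm_le_of_integral_eq_zero K h0 (l := ((2 : ℝ) ^ (j + 1))⁻¹)
      (by positivity) ha ha1 hχ hi hM hH
    have h3 : (((2 : ℝ) ^ (j + 1))⁻¹) ^ a = (2 : ℝ) ^ (-(a * ((j + 1 : ℕ) : ℝ))) := by
      rw [← Real.rpow_natCast, ← Real.rpow_neg (by norm_num), ← Real.rpow_mul (by norm_num)]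
      congr 1; ring
    rw [h3] at h2
    have hq : (0 : ℝ) ≤ (2 : ℝ) ^ (-(a * ((j + 1 : ℕ) : ℝ))) := by positivity
    have h4 := mul_le_mul_of_nonneg_left h2 hB
    have h5 : 0 ≤ B * (P * (2 : ℝ) ^ (-(a * ((j + 1 : ℕ) : ℝ)))) := by positivity
    refine h1.trans (h4.trans ?_)
    linarith

theorem l1Holder_mul {a A P : ℝ} {f : Rd d → ℂ} (hf : Continuous f) (hA : ∀ x, ‖f x‖ ≤ A)
    (hH : ∀ x h, ‖f (x + h) - f x‖ ≤ A * ‖h‖ ^ a) (ψ : 𝓢(Rd d, ℂ)) (hP : ∫ x, ‖ψ x‖ ≤ P)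
    (hψ : L1Holder a ψ P) : L1Holder a (fun x => ψ x * f x) (2 * A * P) := fun h => by
  have hA0 : 0 ≤ A := (norm_nonneg _).trans (hA 0)
  have hψi := ψ.integrable (μ := volume)
  have hs := hψi.comp_add_right h
  have hfc : Continuous fun x => f (x + h) := by fun_prop
  have i1 : Integrable fun x => ‖ψ (x + h) - ψ x‖ * A := (hs.sub hψi).norm.mul_const _
  have i2 : Integrable fun x => ‖ψ x‖ * (A * ‖h‖ ^ a) := hψi.norm.mul_const _
  have i3 : Integrable fun x => ψ (x + h) * f (x + h) - ψ x * f x :=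
    (hs.mul_bdd (c := A) hfc.aestronglyMeasurable (Eventually.of_forall fun x => hA _)).sub
      (hψi.mul_bdd (c := A) hf.aestronglyMeasurable (Eventually.of_forall hA))
  calc ∫ x, ‖ψ (x + h) * f (x + h) - ψ x * f x‖
      ≤ ∫ x, (‖ψ (x + h) - ψ x‖ * A + ‖ψ x‖ * (A * ‖h‖ ^ a)) := by
        refine integral_mono i3.norm (i1.add i2) fun x => ?_
        have e : ψ (x + h) * f (x + h) - ψ x * f x
            = (ψ (x + h) - ψ x) * f (x + h) + ψ x * (f (x + h) - f x) := by ring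
        simp only [e]
        refine (norm_add_le _ _).trans ?_
        rw [norm_mul, norm_mul]
        gcongr
        · exact hA _
        · exact hH _ _
    _ = (∫ x, ‖ψ (x + h) - ψ x‖) * A + (∫ x, ‖ψ x‖) * (A * ‖h‖ ^ a) := by
        rw [integral_add i1 i2, integral_mul_const, integral_mul_const]
    _ ≤ P * ‖h‖ ^ a * A + P * (A * ‖h‖ ^ a) := by
        gcongr
        exact hψ h
    _ = _ := by ring

theorem linftyRep_partialSum (φ : DyadicCutoff d) (n : ℕ) {g : Dist d}
    (hg : ∀ j, linftyNorm (block φ j g) < ⊤) :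
    linftyRep (partialSum φ n g)
      =ᵐ[volume] fun x => ∑ j ∈ Finset.range n, linftyRep (block φ j g) x := by
  have e : partialSum φ n g
      = Lp.toTemperedDistribution (∑ j ∈ Finset.range n, linftyRep (block φ j g)) := by
    have h := map_sum (Lp.toTemperedDistributionCLM (E := Rd d) ℂ volume ⊤)
      (fun j => linftyRep (block φ j g)) (Finset.range n)
    rw [Lp.toTemperedDistributionCLM_apply] at h
    rw [h, partialSum]
    exact Finset.sum_congr rfl fun j _ => (linftyRep_spec (hg j)).1.symm
  rw [e, linftyRep_toTemperedDistribution]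
  exact Lp.coeFn_fun_finsetSum (Finset.range n) fun j => linftyRep (block φ j g)

/-- Only `g` is split into blocks; the partial sum of `f` stays whole as an average. Each term pairs
one block of `g` with the Hölder function `ψ f_n`, so no paraproduct decomposition is needed. -/
theorem mulLinfty_partialSum_apply (φ : DyadicCutoff d) (n : ℕ) {f : Rd d → ℂ}
    (hf : Continuous f) {A : ℝ} (hA : ∀ x, ‖f x‖ ≤ A) {g : Dist d} {B : ℕ → ℝ}
    (hB : ∀ j, 0 ≤ B j) (hg : ∀ j, linftyNorm (block φ j g) ≤ ENNReal.ofReal (B j))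
    (ψ : 𝓢(Rd d, ℂ)) :
    mulLinfty (partialSum φ (n + 1) (ofFun f)) (partialSum φ (n + 1) g) ψ
      = ∑ j ∈ Finset.range (n + 1), ∫ x,
        (ψ x * average φ.kernel (((2 : ℝ) ^ n)⁻¹) f x) * linftyRep (block φ j g) x := by
  set fn := average φ.kernel (((2 : ℝ) ^ n)⁻¹) f with hfn
  have hfnc : Continuous fn := continuous_average _ _ hf hA
  have hfnb : ∀ x, ‖fn x‖ ≤ w11 φ.kernel * A := norm_average_le _ _ hA
  have h1 : linftyRep (partialSum φ (n + 1) (ofFun f)) =ᵐ[volume] fn := by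
    rw [partialSum_ofFun φ n hf hA]
    exact linftyRep_ofFun (memLp_top_of_continuous hfnc hfnb)
  have h2 := linftyRep_partialSum φ (n + 1) fun j => (hg j).trans_lt ENNReal.ofReal_lt_top
  have hb : ∀ᵐ x, ∀ j, ‖linftyRep (block φ j g) x‖ ≤ B j :=
    ae_all_iff.2 fun j => ae_norm_linftyRep_le (hB j) (hg j)
  have hm : MemLp (fun x => linftyRep (partialSum φ (n + 1) (ofFun f)) x *
      linftyRep (partialSum φ (n + 1) g) x) ⊤ (volume : Measure (Rd d)) := by
    refine memLp_top_of_bound ((Lp.aestronglyMeasurable _).mul (Lp.aestronglyMeasurable _))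
      (w11 φ.kernel * A * ∑ j ∈ Finset.range (n + 1), B j) ?_
    filter_upwards [h1, h2, hb] with x e1 e2 e3
    rw [e1, e2, norm_mul]
    refine mul_le_mul (hfnb x) ((norm_sum_le _ _).trans (Finset.sum_le_sum fun j _ => e3 j))
      (norm_nonneg _) ((norm_nonneg _).trans (hfnb 0))
  rw [mulLinfty, ofFun_apply hm, ← integral_finsetSum]
  · refine integral_congr_ae ?_
    filter_upwards [h1, h2] with x e1 e2
    rw [e1, e2, ← mul_assoc, Finset.mul_sum]
  · intro j _
    exact ((ψ.integrable (μ := volume)).mul_bdd (c := w11 φ.kernel * A)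
      hfnc.aestronglyMeasurable (Eventually.of_forall hfnb)).mul_bdd (c := B j)
      (Lp.aestronglyMeasurable _) (ae_norm_linftyRep_le (hB j) (hg j))

/-- Both terms are `L¹` norms of continuous linear images of the function. This makes the limit of
the products a continuous functional. -/
theorem continuous_w11 : Continuous (w11 : 𝓢(Rd d, ℂ) → ℝ) := by
  have e : (w11 : 𝓢(Rd d, ℂ) → ℝ) = fun ψ => ‖SchwartzMap.toLpCLM ℝ ℂ 1 volume ψ‖
      + ‖SchwartzMap.toLpCLM ℝ (Rd d →L[ℝ] ℂ) 1 volume (SchwartzMap.fderivCLM ℝ (Rd d) ℂ ψ)‖ := by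
    ext ψ
    rw [SchwartzMap.toLpCLM_apply, SchwartzMap.toLpCLM_apply, SchwartzMap.norm_toLp_one,
      SchwartzMap.norm_toLp_one]
    simp [w11]
  rw [e]
  fun_prop

/-- Bony's product of a Hölder continuous function and a distribution of negative regularity. -/
theorem norm_bonyMul_apply_le (φ : DyadicCutoff d) {a β : ℝ} (ha : 0 ≤ a) (ha1 : a ≤ 1)
    (hab : 0 < a + β) :
    ∃ C : ℝ, 0 ≤ C ∧ ∀ (f : Rd d → ℂ) (A : ℝ) (g : Dist d) (B : ℝ), Continuous f →
      (∀ x, ‖f x‖ ≤ A) → (∀ x h, ‖f (x + h) - f x‖ ≤ A * ‖h‖ ^ a) → 0 ≤ B →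
      besovNorm φ β g ≤ ENNReal.ofReal B → ∀ (ψ : 𝓢(Rd d, ℂ)) (P : ℝ), ∫ x, ‖ψ x‖ ≤ P →
      L1Holder a ψ P → ‖bonyMul φ (ofFun f) g ψ‖ ≤ C * A * B * P := by
  obtain ⟨C, hC, hCb⟩ := norm_integral_mul_block_le φ ha ha1
  -- A block of `g` has size `2^{-βj}` and its pairing gains `2^{-aj}`; the series converges exactly
  -- because `a + β > 0`.
  set q : ℝ := (2 : ℝ) ^ (-(a + β)) with hq
  have hq0 : 0 < q := by positivity
  have hq1 : q < 1 := Real.rpow_lt_one_of_one_lt_of_neg one_lt_two (by linarith)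
  have hsum : Summable fun j : ℕ => q ^ j := summable_geometric_of_lt_one hq0.le hq1
  have h1q : 0 < (1 - q)⁻¹ := inv_pos.2 (by linarith)
  refine ⟨2 * C * (1 - q)⁻¹, by positivity, fun f A g B hf hA hH hB hg => ?_⟩
  have hA0 : 0 ≤ A := (norm_nonneg _).trans (hA 0)
  set w := w11 φ.kernel with hw
  have hw0 : 0 ≤ w := w11_nonneg _
  set Bj : ℕ → ℝ := fun j => B * (2 : ℝ) ^ (-(β * j)) with hBj
  have hBj0 : ∀ j, 0 ≤ Bj j := fun j => by positivity
  have hgj : ∀ j, linftyNorm (block φ j g) ≤ ENNReal.ofReal (Bj j) := linftyNorm_block_le hg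
  -- Stated for an arbitrary Hölder function because it serves twice: for `f` itself and, with
  -- constant `w * A`, for all its averages.
  have hterm : ∀ (f : Rd d → ℂ) (A : ℝ), Continuous f → (∀ x, ‖f x‖ ≤ A) →
      (∀ x h, ‖f (x + h) - f x‖ ≤ A * ‖h‖ ^ a) → ∀ (ψ : 𝓢(Rd d, ℂ)) (P : ℝ), ∫ x, ‖ψ x‖ ≤ P →
      L1Holder a ψ P → ∀ j, ‖∫ x, (ψ x * f x) * linftyRep (block φ j g) x‖
        ≤ 2 * C * A * B * P * q ^ j := by
    intro f A hf hA hH ψ P hP hψ j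
    have hA0 : 0 ≤ A := (norm_nonneg _).trans (hA 0)
    have hP0 : 0 ≤ P := (integral_nonneg fun x => norm_nonneg _).trans hP
    have hi : Integrable fun x => ψ x * f x := (ψ.integrable (μ := volume)).mul_bdd (c := A)
      hf.aestronglyMeasurable (Eventually.of_forall hA)
    have h1 := hCb g j (Bj j) (hBj0 j) (hgj j) (fun x => ψ x * f x)
      (SchwartzMap.seminorm ℝ 0 0 ψ * A) (2 * A * P) (ψ.continuous.mul hf) hi
      (fun x => by
        rw [norm_mul]
        exact mul_le_mul (SchwartzMap.norm_le_seminorm ℝ ψ x) (hA x) (norm_nonneg _)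
          (by positivity))
      (by
        calc ∫ x, ‖ψ x * f x‖ ≤ ∫ x, ‖ψ x‖ * A :=
              integral_mono hi.norm (ψ.integrable.norm.mul_const A) fun x => by
                simp only [norm_mul]
                exact mul_le_mul_of_nonneg_left (hA x) (norm_nonneg _)
          _ = (∫ x, ‖ψ x‖) * A := integral_mul_const _ _
          _ ≤ P * A := mul_le_mul_of_nonneg_right hP hA0
          _ ≤ 2 * A * P := by nlinarith [mul_nonneg hA0 hP0])
      (l1Holder_mul hf hA hH ψ hP hψ)
    refine h1.trans (le_of_eq ?_)
    have : q ^ j = (2 : ℝ) ^ (-(β * j)) * (2 : ℝ) ^ (-(a * j)) := by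
      rw [hq, ← Real.rpow_natCast, ← Real.rpow_mul (by norm_num), ← Real.rpow_add (by norm_num)]
      congr 1; ring
    rw [this, hBj]; ring
  set T : 𝓢(Rd d, ℂ) → ℕ → ℂ := fun ψ j => ∫ x, (ψ x * f x) * linftyRep (block φ j g) x with hT
  have hPψ : ∀ ψ : 𝓢(Rd d, ℂ), ∫ x, ‖ψ x‖ ≤ 2 * w11 ψ := fun ψ => by
    linarith [integral_norm_le_w11 ψ, w11_nonneg ψ]
  have hHψ : ∀ ψ : 𝓢(Rd d, ℂ), L1Holder a ψ (2 * w11 ψ) := fun ψ => l1Holder_schwartz ψ ha ha1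
  have hTs : ∀ ψ, Summable (T ψ) := fun ψ =>
    Summable.of_norm_bounded (hsum.mul_left _) (hterm f A hf hA hH ψ _ (hPψ ψ) (hHψ ψ))
  have hTle : ∀ (ψ : 𝓢(Rd d, ℂ)) (P : ℝ), ∫ x, ‖ψ x‖ ≤ P → L1Holder a ψ P →
      ‖∑' j, T ψ j‖ ≤ 2 * C * (1 - q)⁻¹ * A * B * P := fun ψ P hP hψ => by
    have := tsum_of_norm_bounded ((hasSum_geometric_of_lt_one hq0.le hq1).mul_left
      (2 * C * A * B * P)) (hterm f A hf hA hH ψ P hP hψ)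
    refine this.trans (le_of_eq (by ring))
  have hint : ∀ (ψ : 𝓢(Rd d, ℂ)) j,
      Integrable fun x => (ψ x * f x) * linftyRep (block φ j g) x := fun ψ j =>
    ((ψ.integrable (μ := volume)).mul_bdd (c := A) hf.aestronglyMeasurable
      (Eventually.of_forall hA)).mul_bdd (c := Bj j) (Lp.aestronglyMeasurable _)
      (ae_norm_linftyRep_le (hBj0 j) (hgj j))
  -- To evaluate `limUnder`, convergence to an actual tempered distribution is needed; the candidate
  -- is the series of pairings with the blocks of `g`.
  let L0 : 𝓢(Rd d, ℂ) →ₗ[ℂ] ℂ :=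
    { toFun := fun ψ => ∑' j, T ψ j
      map_add' := fun ψ χ => by
        rw [← (hTs ψ).tsum_add (hTs χ)]
        congr 1; ext j
        simp only [hT]
        rw [← integral_add (hint ψ j) (hint χ j)]
        congr 1; ext x; simp only [add_apply]; ring
      map_smul' := fun c ψ => by
        rw [RingHom.id_apply, smul_eq_mul, ← tsum_mul_left]
        congr 1; ext j
        simp only [hT]
        rw [← integral_const_mul]
        congr 1; ext x; simp only [smul_apply, smul_eq_mul]; ring }
  have hL0 : Continuous L0 := by
    refine continuous_of_continuousAt_zero L0 ?_
    rw [ContinuousAt, map_zero]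
    refine squeeze_zero_norm (fun ψ => hTle ψ _ (hPψ ψ) (hHψ ψ)) ?_
    have h1 : Tendsto (fun ψ : 𝓢(Rd d, ℂ) => 2 * C * (1 - q)⁻¹ * A * B * (2 * w11 ψ)) (𝓝 0)
        (𝓝 (2 * C * (1 - q)⁻¹ * A * B * (2 * w11 (0 : 𝓢(Rd d, ℂ))))) :=
      ((continuous_w11.tendsto 0).const_mul 2).const_mul _
    have h2 : w11 (0 : 𝓢(Rd d, ℂ)) = 0 := by
      have : ((0 : 𝓢(Rd d, ℂ)) : Rd d → ℂ) = fun _ => 0 := rfl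
      simp [w11, this]
    rwa [h2, mul_zero, mul_zero] at h1
  let L : Dist d := ContinuousLinearMap.toPointwiseConvergenceCLM _ _ _ _ ⟨L0, hL0⟩
  have hlim : Tendsto (fun n : ℕ => mulLinfty (partialSum φ n (ofFun f)) (partialSum φ n g)) atTop
      (𝓝 L) := by
    rw [PointwiseConvergenceCLM.tendsto_iff_forall_tendsto]
    intro ψ
    rw [← tendsto_add_atTop_iff_nat 1]
    set fn : ℕ → Rd d → ℂ := fun n => average φ.kernel (((2 : ℝ) ^ n)⁻¹) f with hfn
    have hfnc : ∀ n, Continuous (fn n) := fun n => continuous_average _ _ hf hA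
    have hfnb : ∀ n x, ‖fn n x‖ ≤ w * A := fun n => norm_average_le _ _ hA
    -- The number of terms and the function `fn n` both vary with `n`; extending the sum by zeros
    -- allows dominated convergence for series.
    have e : ∀ n : ℕ, ∑ j ∈ Finset.range (n + 1),
        ∫ x, (ψ x * fn n x) * linftyRep (block φ j g) x
        = ∑' j, if j < n + 1 then ∫ x, (ψ x * fn n x) * linftyRep (block φ j g) x else 0 := by
      intro n
      rw [tsum_eq_sum (s := Finset.range (n + 1))]
      · exact Finset.sum_congr rfl fun j hj => by rw [if_pos (Finset.mem_range.1 hj)]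
      · exact fun j hj => if_neg (by simpa using hj)
    refine Tendsto.congr
      (fun n => ((mulLinfty_partialSum_apply φ n hf hA hBj0 hgj ψ).trans (e n)).symm) ?_
    refine tendsto_tsum_of_dominated_convergence
      (bound := fun j => 2 * C * (w * A) * B * (2 * w11 ψ) * q ^ j) (hsum.mul_left _)
      (fun j => ?_) (Eventually.of_forall fun n j => ?_)
    · have h1 : Tendsto (fun n => ∫ x, (ψ x * fn n x) * linftyRep (block φ j g) x) atTop
          (𝓝 (∫ x, (ψ x * f x) * linftyRep (block φ j g) x)) := by
        refine tendsto_integral_of_dominated_convergence (fun x => ‖ψ x‖ * (w * A) * Bj j)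
          (fun n => (ψ.continuous.mul (hfnc n)).aestronglyMeasurable.mul
            (Lp.aestronglyMeasurable _)) ((ψ.integrable.norm.mul_const _).mul_const _)
          (fun n => ?_) (Eventually.of_forall fun x => ?_)
        · filter_upwards [ae_norm_linftyRep_le (hBj0 j) (hgj j)] with x hx
          rw [norm_mul, norm_mul]
          gcongr
          exact hfnb n x
        · exact ((tendsto_average φ.kernel hf hA tendsto_inv_two_pow φ.integral_kernel
            x).const_mul _).mul_const _
      refine h1.congr' ?_
      filter_upwards [eventually_ge_atTop j] with n hn
      rw [if_pos (by omega)]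
    · have hnn : 0 ≤ 2 * C * (w * A) * B * (2 * w11 ψ) * q ^ j := by
        have := w11_nonneg ψ; positivity
      split_ifs
      · exact hterm (fn n) (w * A) (hfnc n) (hfnb n) (norm_average_sub_le _ _ hf hA hH) ψ _
          (hPψ ψ) (hHψ ψ) j
      · simpa using hnn
  intro ψ P hP hψ
  rw [bonyMul, hlim.limUnder_eq]
  exact hTle ψ P hP hψ

/-! ### Regularity of the gradient -/

/-- For a continuous function the set where the bound holds is closed and of full measure, hence
everything. -/
theorem norm_le_of_schwartz {f : Rd d → ℂ} (hf : Continuous f) {A M : ℝ} (hA : ∀ x, ‖f x‖ ≤ A)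
    (hM : 0 ≤ M) (h : ∀ ψ : 𝓢(Rd d, ℂ), ‖∫ x, ψ x * f x‖ ≤ M * ∫ x, ‖ψ x‖) (x : Rd d) :
    ‖f x‖ ≤ M := by
  have h1 := ae_norm_le_of_schwartz hf.aestronglyMeasurable (Eventually.of_forall hA) h hM
  have h2 : Dense {x | ‖f x‖ ≤ M} := Measure.dense_of_ae h1
  have h3 : IsClosed {x | ‖f x‖ ≤ M} := isClosed_le hf.norm continuous_const
  have h4 := h2.closure_eq
  rw [h3.closure_eq] at h4
  exact (h4 ▸ Set.mem_univ x : x ∈ {x | ‖f x‖ ≤ M})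

/-- The low frequency parts are averages against an approximate identity and converge weakly to `f`,
so bounds on blocks add up. -/
theorem norm_ofFun_apply_le_tsum (φ : DyadicCutoff d) {f : Rd d → ℂ} (hf : Continuous f) {A : ℝ}
    (hA : ∀ x, ‖f x‖ ≤ A) (ψ : 𝓢(Rd d, ℂ)) {c : ℕ → ℝ} {s : ℝ} (hc : HasSum c s)
    (h : ∀ j, ‖block φ j (ofFun f) ψ‖ ≤ c j) : ‖∫ x, ψ x * f x‖ ≤ s := by
  rw [← ofFun_apply (memLp_top_of_continuous hf hA)]
  refine le_of_tendsto (tendsto_partialSum_ofFun φ hf hA ψ).norm (Eventually.of_forall fun n => ?_)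
  have e : partialSum φ (n + 1) (ofFun f) ψ
      = ∑ j ∈ Finset.range (n + 1), block φ j (ofFun f) ψ := by
    simp [partialSum]
  rw [e]
  refine (norm_sum_le _ _).trans ((Finset.sum_le_sum fun j _ => h j).trans ?_)
  exact sum_le_hasSum _ (fun j _ => (norm_nonneg _).trans (h j)) hc

/-- The symbol of a derivative, localized to low frequencies. -/
def DyadicCutoff.derivSymbol (φ : DyadicCutoff d) (v : Rd d) : 𝓢(Rd d, ℂ) :=
  (2 * Real.pi * Complex.I : ℂ) •
    SchwartzMap.smulLeftCLM ℂ (fun ξ : Rd d => ((inner ℝ ξ v : ℝ) : ℂ)) φ.fat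

theorem hasTemperateGrowth_inner (v : Rd d) :
    Function.HasTemperateGrowth (fun ξ : Rd d => ((inner ℝ ξ v : ℝ) : ℂ)) :=
  Function.HasTemperateGrowth.comp
    Function.Complex.hasTemperateGrowth_ofReal (Function.hasTemperateGrowth_inner_left v)

theorem DyadicCutoff.derivSymbol_apply (φ : DyadicCutoff d) (v ξ : Rd d) :
    φ.derivSymbol v ξ = 2 * Real.pi * Complex.I * (((inner ℝ ξ v : ℝ) : ℂ) * φ.fat ξ) := by
  simp [DyadicCutoff.derivSymbol, SchwartzMap.smulLeftCLM_apply_apply (hasTemperateGrowth_inner v)]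

/-- On the support of `φ_j` the factor `fat` is `1`, so the symbol of the derivative is `2^j` times
a dilate of one fixed Schwartz symbol. -/
theorem block_lineDeriv_apply (φ : DyadicCutoff d) (j : ℕ) (v : Rd d) (D : Dist d)
    (ψ : 𝓢(Rd d, ℂ)) :
    block φ j (∂_{v} D) ψ = (2 : ℂ) ^ j *
      block φ j D (adjMult (fun ξ => φ.derivSymbol v (((2 : ℝ) ^ j)⁻¹ • ξ)) ψ) := by
  have h1 := φ.hasTemperateGrowth_part j
  have h2 := hasTemperateGrowth_inner (d := d) v
  have h3 := hasTemperateGrowth_dilate (φ.derivSymbol v) ((2 : ℝ) ^ j)⁻¹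
  rw [← fourierMultiplier_apply, TemperedDistribution.lineDeriv_eq_fourierMultiplierCLM, block,
    block, map_smul,
    TemperedDistribution.fourierMultiplierCLM_fourierMultiplierCLM_apply h2 h1,
    TemperedDistribution.fourierMultiplierCLM_fourierMultiplierCLM_apply h1 h3]
  have e : ((fun ξ => ((φ.part j ξ : ℝ) : ℂ)) *
      fun ξ => φ.derivSymbol v (((2 : ℝ) ^ j)⁻¹ • ξ)) =
      (2 * Real.pi * Complex.I * ((2 : ℂ) ^ j)⁻¹) •
        ((fun ξ : Rd d => ((inner ℝ ξ v : ℝ) : ℂ)) * fun ξ => ((φ.part j ξ : ℝ) : ℂ)) := by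
    ext ξ
    simp only [Pi.mul_apply, Pi.smul_apply, smul_eq_mul, φ.derivSymbol_apply, real_inner_smul_left]
    conv_rhs => rw [← φ.part_mul_fat j ξ]
    push_cast
    ring
  rw [e, TemperedDistribution.fourierMultiplierCLM_smul (h2.mul h1)]
  simp only [smul_apply, smul_eq_mul]
  have : (2 : ℂ) ^ j ≠ 0 := pow_ne_zero _ two_ne_zero
  field_simp

/-- A block of a partial derivative has size `2^j 2^{-(α+1)j} = 2^{-αj}`, and an increment by `h`
costs a further `2^{aj} ‖h‖^a`. Giving up `α - a > 0` makes the sum over blocks a geometric series.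
-/
theorem norm_gradient_le (φ : DyadicCutoff d) {a α : ℝ} (ha : 0 ≤ a) (ha1 : a ≤ 1) (haα : a < α) :
    ∃ C : ℝ, 0 ≤ C ∧ ∀ (D : Dist d) (N : ℝ) (g : Rd d → Rd d), 0 ≤ N →
      besovNorm φ (α + 1) D ≤ ENNReal.ofReal N → IsGradient D g →
      (∀ x, ‖g x‖ ≤ C * N) ∧ ∀ x h, ‖g (x + h) - g x‖ ≤ C * N * ‖h‖ ^ a := by
  set e : Fin d → Rd d := fun i => EuclideanSpace.single i (1 : ℝ)
  set W : Fin d → ℝ := fun i => w11 (FourierTransform.fourier (φ.derivSymbol (e i)) : 𝓢(Rd d, ℂ))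
  have hW : ∀ i, 0 ≤ W i := fun i => w11_nonneg _
  set q : ℝ := (2 : ℝ) ^ (a - α) with hq
  have hq0 : 0 < q := by positivity
  have hq1 : q < 1 := Real.rpow_lt_one_of_one_lt_of_neg one_lt_two (by linarith)
  have h1q : 0 < (1 - q)⁻¹ := inv_pos.2 (by linarith)
  have hgeo := hasSum_geometric_of_lt_one hq0.le hq1
  refine ⟨∑ i, 2 * W i * (1 - q)⁻¹, Finset.sum_nonneg fun i _ => by have := hW i; positivity,
    fun D N g hN hD hg => ?_⟩
  obtain ⟨hgc, ⟨M, hM⟩, hgd⟩ := hg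
  have hc : ∀ i, Continuous fun x => ((g x i : ℝ) : ℂ) := fun i => by fun_prop
  have hb : ∀ i x, ‖((g x i : ℝ) : ℂ)‖ ≤ M := fun i x => by
    rw [Complex.norm_real]
    exact (PiLp.norm_apply_le (g x) i).trans (hM x)
  -- the blocks of the components
  have hbl : ∀ i j (ψ : 𝓢(Rd d, ℂ)), ‖block φ j (ofFun fun x => ((g x i : ℝ) : ℂ)) ψ‖
      ≤ (2 : ℝ) ^ j * (N * (2 : ℝ) ^ (-((α + 1) * j)) *
        ∫ x, ‖adjMult (fun ξ => φ.derivSymbol (e i) (((2 : ℝ) ^ j)⁻¹ • ξ)) ψ x‖) := by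
    intro i j ψ
    rw [← hgd i, block_lineDeriv_apply, norm_mul, norm_pow, Complex.norm_ofNat]
    gcongr
    exact norm_apply_le_of_linftyNorm_le (by positivity) (linftyNorm_block_le hD j) _
  have hpow : ∀ j : ℕ, (2 : ℝ) ^ j * (2 : ℝ) ^ (-((α + 1) * j)) * (2 : ℝ) ^ (a * j) = q ^ j := by
    intro j
    rw [hq, ← Real.rpow_natCast, ← Real.rpow_natCast, ← Real.rpow_mul (by norm_num),
      ← Real.rpow_add (by norm_num), ← Real.rpow_add (by norm_num)]
    congr 1; ring
  -- The sup bound wastes this factor so that both bounds use the same series in `q`.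
  have h2a : ∀ j : ℕ, (1 : ℝ) ≤ (2 : ℝ) ^ (a * j) := fun j =>
    Real.one_le_rpow one_le_two (by positivity)
  have hfst : ∀ i x, ‖((g x i : ℝ) : ℂ)‖ ≤ 2 * W i * (1 - q)⁻¹ * N := by
    intro i
    have := hW i
    refine norm_le_of_schwartz (hc i) (hb i) (by positivity) fun ψ => ?_
    have h0 : 0 ≤ ∫ x, ‖ψ x‖ := integral_nonneg fun x => norm_nonneg _
    have hS : 2 * W i * N * (∫ x, ‖ψ x‖) * (1 - q)⁻¹
        = 2 * W i * (1 - q)⁻¹ * N * ∫ x, ‖ψ x‖ := by ring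
    refine norm_ofFun_apply_le_tsum φ (hc i) (hb i) ψ
      (c := fun j => 2 * W i * N * (∫ x, ‖ψ x‖) * q ^ j)
      (hS ▸ hgeo.mul_left (2 * W i * N * ∫ x, ‖ψ x‖)) fun j => ?_
    refine (hbl i j ψ).trans ?_
    have h1 := adjMult_dilate_norm_le (φ.derivSymbol (e i)) ((2 : ℝ) ^ j)⁻¹ ψ
    have h2 : W i * ∫ x, ‖ψ x‖ ≤ 2 * W i * (∫ x, ‖ψ x‖) * (2 : ℝ) ^ (a * j) := by
      have h3 := h2a j
      have h4 := mul_nonneg (hW i) h0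
      nlinarith
    calc _ ≤ (2 : ℝ) ^ j * (N * (2 : ℝ) ^ (-((α + 1) * j)) *
          (2 * W i * (∫ x, ‖ψ x‖) * (2 : ℝ) ^ (a * j))) := by
          gcongr
          exact h1.trans h2
      _ = _ := by rw [← hpow j]; ring
  have hsnd : ∀ i x h, ‖((g (x + h) i : ℝ) : ℂ) - ((g x i : ℝ) : ℂ)‖
      ≤ 2 * W i * (1 - q)⁻¹ * N * ‖h‖ ^ a := by
    intro i x h
    have := hW i
    refine norm_le_of_schwartz (f := fun x => ((g (x + h) i : ℝ) : ℂ) - ((g x i : ℝ) : ℂ))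
      (A := M + M) (by fun_prop) (fun x => (norm_sub_le _ _).trans (add_le_add (hb i _) (hb i _)))
      (by positivity) (fun ψ => ?_) x
    have h0 : 0 ≤ ∫ x, ‖ψ x‖ := integral_nonneg fun x => norm_nonneg _
    -- The increment of `g` is moved to the test function, where the multiplier kernel supplies the
    -- Hölder bound.
    set χ : 𝓢(Rd d, ℂ) := SchwartzMap.compSubConstCLM ℂ h ψ - ψ with hχ
    have hχa : ∀ x, χ x = ψ (x - h) - ψ x := fun x => by simp [hχ]
    have i1 : ∀ η : 𝓢(Rd d, ℂ), Integrable fun x => η x * ((g x i : ℝ) : ℂ) := fun η =>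
      (η.integrable (μ := volume)).mul_bdd (c := M) (hc i).aestronglyMeasurable
        (Eventually.of_forall (hb i))
    have e1 : ∫ x, ψ x * (((g (x + h) i : ℝ) : ℂ) - ((g x i : ℝ) : ℂ))
        = ∫ x, χ x * ((g x i : ℝ) : ℂ) := by
      have i2 : Integrable fun x => ψ (x - h) * ((g x i : ℝ) : ℂ) := by
        simpa using i1 (SchwartzMap.compSubConstCLM ℂ h ψ)
      have i3 : Integrable fun x => ψ x * ((g (x + h) i : ℝ) : ℂ) := by
        simpa using i2.comp_add_right h
      simp only [hχa, sub_mul, mul_sub]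
      rw [integral_sub i2 (i1 ψ), integral_sub i3 (i1 ψ),
        ← integral_add_right_eq_self (fun x => ψ (x - h) * ((g x i : ℝ) : ℂ)) h]
      simp
    rw [e1]
    have hS : 2 * W i * N * ‖h‖ ^ a * (∫ x, ‖ψ x‖) * (1 - q)⁻¹
        = 2 * W i * (1 - q)⁻¹ * N * ‖h‖ ^ a * ∫ x, ‖ψ x‖ := by ring
    refine norm_ofFun_apply_le_tsum φ (hc i) (hb i) χ
      (c := fun j => 2 * W i * N * ‖h‖ ^ a * (∫ x, ‖ψ x‖) * q ^ j)
      (hS ▸ hgeo.mul_left (2 * W i * N * ‖h‖ ^ a * ∫ x, ‖ψ x‖)) fun j => ?_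
    refine (hbl i j χ).trans ?_
    have h1 := l1Holder_adjMult_dilate (φ.derivSymbol (e i)) (l := ((2 : ℝ) ^ j)⁻¹) (by positivity)
      ha ha1 ψ (-h)
    have h2 : (((2 : ℝ) ^ j)⁻¹)⁻¹ ^ a = (2 : ℝ) ^ (a * j) := by
      rw [inv_inv, ← Real.rpow_natCast, ← Real.rpow_mul (by norm_num), mul_comm]
    have h3 : ∀ x, adjMult (fun ξ => φ.derivSymbol (e i) (((2 : ℝ) ^ j)⁻¹ • ξ)) χ x
        = adjMult (fun ξ => φ.derivSymbol (e i) (((2 : ℝ) ^ j)⁻¹ • ξ)) ψ (x + -h)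
          - adjMult (fun ξ => φ.derivSymbol (e i) (((2 : ℝ) ^ j)⁻¹ • ξ)) ψ x := by
      intro x
      have i4 : ∀ (η : 𝓢(Rd d, ℂ)) x, Integrable fun y =>
          (FourierTransform.fourier (φ.derivSymbol (e i)) : 𝓢(Rd d, ℂ)) y
            * η (x - ((2 : ℝ) ^ j)⁻¹ • y) := fun η x =>
        ((FourierTransform.fourier (φ.derivSymbol (e i)) : 𝓢(Rd d, ℂ)).integrable
          (μ := volume)).mul_bdd (c := SchwartzMap.seminorm ℝ 0 0 η)
          (by have := η.continuous; fun_prop : Continuous fun y : Rd d =>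
            η (x - ((2 : ℝ) ^ j)⁻¹ • y)).aestronglyMeasurable
          (Eventually.of_forall fun y => SchwartzMap.norm_le_seminorm ℝ η _)
      simp only [adjMult_dilate_apply, dilConv, hχa]
      rw [← integral_sub (i4 ψ _) (i4 ψ _)]
      congr 1; ext y
      rw [mul_sub, ← sub_eq_add_neg, sub_right_comm]
    simp only [h3]
    rw [h2, norm_neg] at h1
    calc _ ≤ (2 : ℝ) ^ j * (N * (2 : ℝ) ^ (-((α + 1) * j)) *
          (2 * W i * (∫ x, ‖ψ x‖) * (2 : ℝ) ^ (a * j) * ‖h‖ ^ a)) := by gcongr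
      _ = _ := by rw [← hpow j]; ring
  have hsum : ∀ v : Rd d, ‖v‖ ≤ ∑ i, ‖((v i : ℝ) : ℂ)‖ := fun v => by
    have h1 : v = ∑ i, v i • e i := by
      ext k; simp [e, Finset.sum_apply, Pi.single_apply]
    conv_lhs => rw [h1]
    refine (norm_sum_le _ _).trans (Finset.sum_le_sum fun i _ => ?_)
    rw [norm_smul, Complex.norm_real]
    simp [e]
  refine ⟨fun x => (hsum _).trans ?_, fun x h => (hsum _).trans ?_⟩
  · rw [Finset.sum_mul]
    exact Finset.sum_le_sum fun i _ => hfst i x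
  · rw [Finset.sum_mul, Finset.sum_mul]
    refine Finset.sum_le_sum fun i _ => ?_
    have := hsnd i x h
    simpa using this

/-! ### The heat semigroup -/

/-- A Schwartz function on the line that is equal to `exp (-s)` for `s ≥ 0`. -/
def expNeg : 𝓢(ℝ, ℂ) where
  toFun s := ((Real.smoothTransition (s + 1) * Real.exp (-s) : ℝ) : ℂ)
  smooth' := by
    refine Complex.ofRealCLM.contDiff.comp (ContDiff.mul ?_ ?_)
    · exact Real.smoothTransition.contDiff.comp (contDiff_id.add contDiff_const)
    · exact Real.contDiff_exp.comp contDiff_neg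
  decay' k n := by
    set η : ℝ → ℂ := fun s => ((Real.smoothTransition (s + 1) * Real.exp (-s) : ℝ) : ℂ) with hη
    have hs : ContDiff ℝ ∞ η := by
      refine Complex.ofRealCLM.contDiff.comp (ContDiff.mul ?_ ?_)
      · exact Real.smoothTransition.contDiff.comp (contDiff_id.add contDiff_const)
      · exact Real.contDiff_exp.comp contDiff_neg
    have hc : Continuous fun s : ℝ => ‖s‖ ^ k * ‖iteratedFDeriv ℝ n η s‖ :=
      (continuous_norm.pow k).mul (hs.continuous_iteratedFDeriv (mod_cast le_top)).norm
    obtain ⟨C, hC⟩ := (isCompact_Icc (a := (-1 : ℝ)) (b := 0)).exists_bound_of_continuousOn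
      hc.continuousOn
    -- The function is zero left of `-1`, bounded by compactness on `[-1, 0]`, and equal to `exp
    -- (-s)` on the right, where `s^k ≤ k! e^s`.
    refine ⟨max C k.factorial, fun s => ?_⟩
    rcases lt_trichotomy s (-1) with h | h | h
    · have h0 : η =ᶠ[𝓝 s] fun _ => 0 := by
        filter_upwards [Iio_mem_nhds h] with x hx
        simp [hη, Real.smoothTransition.zero_of_nonpos (show x + 1 ≤ 0 by
          linarith [Set.mem_Iio.1 hx])]
      rw [(h0.iteratedFDeriv ℝ n).eq_of_nhds]
      refine le_max_of_le_right ?_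
      simp
    · refine le_max_of_le_left ((le_abs_self _).trans (hC s ⟨h.ge, by linarith⟩))
    · rcases le_or_gt s 0 with h1 | h1
      · exact le_max_of_le_left ((le_abs_self _).trans (hC s ⟨h.le, h1⟩))
      · refine le_max_of_le_right ?_
        have h0 : η =ᶠ[𝓝 s] fun x => Complex.exp (((-1 : ℝ) : ℂ) * x) := by
          filter_upwards [Ioi_mem_nhds h1] with x hx
          simp [hη, Real.smoothTransition.one_of_one_le (show 1 ≤ x + 1 by
            linarith [Set.mem_Ioi.1 hx])]
        have h2 : ∀ n : ℕ, iteratedDeriv n (fun x : ℝ => Complex.exp (((-1 : ℝ) : ℂ) * x))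
            = fun x : ℝ => ((-1 : ℝ) : ℂ) ^ n * Complex.exp (((-1 : ℝ) : ℂ) * x) := by
          intro n
          induction n with
          | zero => simp
          | succ n ih =>
            rw [iteratedDeriv_succ, ih]
            ext x
            have h3 : HasDerivAt (fun x : ℝ => Complex.exp (((-1 : ℝ) : ℂ) * x))
                (Complex.exp (((-1 : ℝ) : ℂ) * x) * ((-1 : ℝ) : ℂ)) x := by
              have := (Complex.ofRealCLM.hasDerivAt (x := x)).const_mul ((-1 : ℝ) : ℂ)
              simpa using this.cexp
            rw [(h3.const_mul _).deriv, pow_succ]; ring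
        rw [(h0.iteratedFDeriv ℝ n).eq_of_nhds, norm_iteratedFDeriv_eq_norm_iteratedDeriv, h2]
        have h4 : ‖Complex.exp (((-1 : ℝ) : ℂ) * s)‖ = Real.exp (-s) := by
          rw [Complex.norm_exp]; simp
        have h5 := Real.pow_div_factorial_le_exp s h1.le k
        rw [div_le_iff₀ (by positivity)] at h5
        rw [norm_mul, norm_pow, h4, Real.norm_of_nonneg h1.le]
        simp only [Complex.ofReal_neg, Complex.ofReal_one, norm_neg, norm_one, one_pow, one_mul]
        rw [Real.exp_neg, ← div_eq_mul_inv, div_le_iff₀ (Real.exp_pos s)]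
        linarith

theorem expNeg_apply {s : ℝ} (hs : 0 ≤ s) : expNeg s = ((Real.exp (-s) : ℝ) : ℂ) := by
  change ((Real.smoothTransition (s + 1) * Real.exp (-s) : ℝ) : ℂ) = _
  rw [Real.smoothTransition.one_of_one_le (by linarith), one_mul]

theorem hasTemperateGrowth_laplaceSymbol :
    Function.HasTemperateGrowth fun ξ : Rd d => (2 * Real.pi * ‖ξ‖) ^ 2 := by
  have h : (fun ξ : Rd d => (2 * Real.pi * ‖ξ‖) ^ 2)
      = fun ξ : Rd d => (2 * Real.pi) ^ 2 * ‖ξ‖ ^ 2 := by ext ξ; ring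
  rw [h]
  exact (Function.HasTemperateGrowth.const _).mul (Function.hasTemperateGrowth_norm_sq (Rd d))

/-- The symbol of the heat semigroup at time `1`. -/
def gaussianSymbol (d : ℕ) : 𝓢(Rd d, ℂ) :=
  SchwartzMap.compCLM ℂ hasTemperateGrowth_laplaceSymbol
    -- Composition preserves Schwartz decay because `‖ξ‖` is dominated by a power of `1` plus the
    -- inner function.
    ⟨1, 1, fun ξ => by
      rw [pow_one, one_mul, Real.norm_of_nonneg (by positivity)]
      have := Real.pi_gt_three
      nlinarith [sq_nonneg (‖ξ‖ - 1), sq_nonneg ‖ξ‖,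
        mul_nonneg (sq_nonneg ‖ξ‖) (sq_nonneg (Real.pi - 1))]⟩ expNeg

theorem gaussianSymbol_apply (ξ : Rd d) :
    gaussianSymbol d ξ = ((Real.exp (-(2 * Real.pi * ‖ξ‖) ^ 2) : ℝ) : ℂ) :=
  expNeg_apply (by positivity)

/-- The symbol of `-Δ` times the heat semigroup at time `1`. -/
def laplaceGaussianSymbol (d : ℕ) : 𝓢(Rd d, ℂ) :=
  SchwartzMap.smulLeftCLM ℂ (fun ξ : Rd d => (((2 * Real.pi * ‖ξ‖) ^ 2 : ℝ) : ℂ))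
    (gaussianSymbol d)

theorem laplaceGaussianSymbol_apply (ξ : Rd d) :
    laplaceGaussianSymbol d ξ
      = (((2 * Real.pi * ‖ξ‖) ^ 2 : ℝ) : ℂ) * gaussianSymbol d ξ := by
  rw [laplaceGaussianSymbol, SchwartzMap.smulLeftCLM_apply_apply, smul_eq_mul]
  exact Function.HasTemperateGrowth.comp Function.Complex.hasTemperateGrowth_ofReal
    hasTemperateGrowth_laplaceSymbol

theorem heatSymbol_eq {t : ℝ} (ht : 0 ≤ t) :
    (fun ξ : Rd d => ((Real.exp (-t * (2 * Real.pi * ‖ξ‖) ^ 2) : ℝ) : ℂ))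
      = fun ξ => gaussianSymbol d (√t • ξ) := by
  ext ξ
  rw [gaussianSymbol_apply, norm_smul, Real.norm_of_nonneg (Real.sqrt_nonneg t)]
  congr 3
  rw [show 2 * Real.pi * (√t * ‖ξ‖) = √t * (2 * Real.pi * ‖ξ‖) by ring, mul_pow √t, Real.sq_sqrt ht]
  ring

/-- The annular cutoff divided by the symbol of `-Δ`. -/
def DyadicCutoff.invAnnulus (φ : DyadicCutoff d) : 𝓢(Rd d, ℂ) :=
  HasCompactSupport.toSchwartzMap
    (f := fun ξ => φ.annulus ξ * (((2 * Real.pi * ‖ξ‖) ^ 2 : ℝ) : ℂ)⁻¹)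
    (HasCompactSupport.intro (isCompact_closedBall (0 : Rd d) (3 / 2)) fun ξ hξ => by
      have h1 : 3 / 2 ≤ ‖ξ‖ := (not_le.1 (by simpa using hξ)).le
      have h2 : 3 / 2 ≤ ‖(2 : ℝ) • ξ‖ := by rw [norm_smul]; norm_num; linarith
      simp [DyadicCutoff.annulus, φ.eq_zero _ h1, φ.eq_zero _ h2])
    (contDiff_iff_contDiffAt.2 fun ξ => by
      -- The quotient is smooth at the origin because the annular cutoff vanishes near it.
      rcases eq_or_ne ξ 0 with rfl | hξ
      · refine (contDiffAt_const (c := (0 : ℂ))).congr_of_eventuallyEq ?_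
        filter_upwards [Metric.ball_mem_nhds (0 : Rd d) (show (0 : ℝ) < 1 / 2 by norm_num)]
          with x hx
        have : φ.annulus x = 0 := by
          by_contra h
          have := φ.le_norm_of_annulus_ne_zero h
          simp only [Metric.mem_ball, dist_zero_right] at hx
          linarith
        simp [this]
      · have h1 : ContDiff ℝ ∞ fun ξ : Rd d => (((2 * Real.pi * ‖ξ‖) ^ 2 : ℝ) : ℂ) :=
          Complex.ofRealCLM.contDiff.comp hasTemperateGrowth_laplaceSymbol.1
        refine ((φ.annulus.smooth ⊤).contDiffAt).mul (h1.contDiffAt.inv ?_)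
        have : 0 < ‖ξ‖ := norm_pos_iff.2 hξ
        exact_mod_cast (by positivity : (2 * Real.pi * ‖ξ‖) ^ 2 ≠ 0))

theorem DyadicCutoff.invAnnulus_apply (φ : DyadicCutoff d) (ξ : Rd d) :
    φ.invAnnulus ξ = φ.annulus ξ * (((2 * Real.pi * ‖ξ‖) ^ 2 : ℝ) : ℂ)⁻¹ := rfl

theorem DyadicCutoff.invAnnulus_mul (φ : DyadicCutoff d) (ξ : Rd d) :
    φ.invAnnulus ξ * (((2 * Real.pi * ‖ξ‖) ^ 2 : ℝ) : ℂ) = φ.annulus ξ := by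
  rw [φ.invAnnulus_apply]
  by_cases h : φ.annulus ξ = 0
  · simp [h]
  · have h1 := φ.le_norm_of_annulus_ne_zero h
    have h2 : (((2 * Real.pi * ‖ξ‖) ^ 2 : ℝ) : ℂ) ≠ 0 := by
      have : 0 < ‖ξ‖ := by linarith
      exact_mod_cast (by positivity : (2 * Real.pi * ‖ξ‖) ^ 2 ≠ 0)
    rw [mul_assoc, inv_mul_cancel₀ h2, mul_one]

/-- The heat multiplier is the dilate by `√t` of a fixed symbol, so its bound is uniform in `t`.
This handles the initial datum. -/
theorem norm_block_heat_apply_le (φ : DyadicCutoff d) {D : Dist d} {k : ℕ} {B t : ℝ} (hB : 0 ≤ B)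
    (ht : 0 ≤ t) (hD : linftyNorm (block φ k D) ≤ ENNReal.ofReal B) (ψ : 𝓢(Rd d, ℂ)) :
    ‖block φ k (heat t D) ψ‖
      ≤ w11 (FourierTransform.fourier (gaussianSymbol d) : 𝓢(Rd d, ℂ)) * B * ∫ x, ‖ψ x‖ := by
  have h1 := φ.hasTemperateGrowth_part k
  have h2 := hasTemperateGrowth_dilate (gaussianSymbol d) (√t)
  have e : block φ k (heat t D) ψ
      = block φ k D (adjMult (fun ξ => gaussianSymbol d (√t • ξ)) ψ) := by
    rw [← fourierMultiplier_apply, heat, heatSymbol_eq ht, block, block,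
      TemperedDistribution.fourierMultiplierCLM_fourierMultiplierCLM_apply h2 h1,
      TemperedDistribution.fourierMultiplierCLM_fourierMultiplierCLM_apply h1 h2, mul_comm]
  rw [e]
  refine (norm_apply_le_of_linftyNorm_le hB hD _).trans ?_
  calc _ ≤ B * (w11 (FourierTransform.fourier (gaussianSymbol d) : 𝓢(Rd d, ℂ)) * ∫ x, ‖ψ x‖) :=
        mul_le_mul_of_nonneg_left (adjMult_dilate_norm_le _ _ ψ) hB
    _ = _ := by ring

/-- Bound for the composition of two multipliers, applied to a distribution that is continuous with
respect to a Besov type norm of test functions. -/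
theorem norm_apply_adjMult_adjMult_le {a Q l r : ℝ} (ha : 0 ≤ a) (ha1 : a ≤ 1) (hQ : 0 ≤ Q)
    (hl : 0 < l) (hl1 : l ≤ 1) {D : Dist d}
    (hD : ∀ (ψ : 𝓢(Rd d, ℂ)) (P : ℝ), ∫ x, ‖ψ x‖ ≤ P → L1Holder a ψ P → ‖D ψ‖ ≤ Q * P)
    (m E : 𝓢(Rd d, ℂ)) (ψ : 𝓢(Rd d, ℂ)) :
    ‖D (adjMult (fun ξ => m (l • ξ)) (adjMult (fun ξ => E (r • ξ)) ψ))‖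
      ≤ 2 * w11 (FourierTransform.fourier m : 𝓢(Rd d, ℂ))
        * w11 (FourierTransform.fourier E : 𝓢(Rd d, ℂ)) * Q * (l⁻¹) ^ a * ∫ x, ‖ψ x‖ := by
  set η := adjMult (fun ξ => E (r • ξ)) ψ
  have h1 : ∫ x, ‖η x‖ ≤ _ := adjMult_dilate_norm_le E r ψ
  have h2 := adjMult_dilate_norm_le m l η
  have h3 := l1Holder_adjMult_dilate m hl ha ha1 η
  have hm := w11_nonneg (FourierTransform.fourier m : 𝓢(Rd d, ℂ))
  have hE := w11_nonneg (FourierTransform.fourier E : 𝓢(Rd d, ℂ))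
  -- As `l ≤ 1`, the Hölder constant also dominates the `L¹` norm, so one value of `P` meets both
  -- conditions of `hD`.
  have h4 : 1 ≤ (l⁻¹) ^ a := Real.one_le_rpow ((one_le_inv₀ hl).2 hl1) ha
  have h0 : 0 ≤ ∫ x, ‖η x‖ := integral_nonneg fun x => norm_nonneg _
  have h5 := hD _ _ (h2.trans (by nlinarith [mul_nonneg hm h0])) h3
  refine h5.trans ?_
  calc _ ≤ Q * (2 * w11 (FourierTransform.fourier m : 𝓢(Rd d, ℂ)) *
        (w11 (FourierTransform.fourier E : 𝓢(Rd d, ℂ)) * ∫ x, ‖ψ x‖) * (l⁻¹) ^ a) := by gcongr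
    _ = _ := by ring

/-- The factorization of the symbol is left free, since the smoothing estimate compares two of them
for the same block. -/
theorem block_heat_apply (φ : DyadicCutoff d) {k : ℕ} {t l r : ℝ} (ht : 0 ≤ t) {c : ℂ}
    (m E : 𝓢(Rd d, ℂ))
    (h : ∀ ξ, φ.profile k (((2 : ℝ) ^ k)⁻¹ • ξ) * gaussianSymbol d (√t • ξ)
      = c * (m (l • ξ) * E (r • ξ))) (D : Dist d) (ψ : 𝓢(Rd d, ℂ)) :
    block φ k (heat t D) ψ
      = c * D (adjMult (fun ξ => m (l • ξ)) (adjMult (fun ξ => E (r • ξ)) ψ)) := by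
  have h1 := φ.hasTemperateGrowth_part k
  have h2 := hasTemperateGrowth_dilate (gaussianSymbol d) (√t)
  have h3 := hasTemperateGrowth_dilate m l
  have h4 := hasTemperateGrowth_dilate E r
  rw [← fourierMultiplier_apply, ← fourierMultiplier_apply, heat, heatSymbol_eq ht, block,
    TemperedDistribution.fourierMultiplierCLM_fourierMultiplierCLM_apply h2 h1,
    TemperedDistribution.fourierMultiplierCLM_fourierMultiplierCLM_apply h3 h4, φ.part_eq]
  have e : ((fun ξ => gaussianSymbol d (√t • ξ)) * fun ξ => φ.profile k (((2 : ℝ) ^ k)⁻¹ • ξ))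
      = c • ((fun ξ => m (l • ξ)) * fun ξ => E (r • ξ)) := by
    ext ξ
    simp only [Pi.mul_apply, Pi.smul_apply, smul_eq_mul]
    rw [mul_comm, h ξ]
  rw [e, TemperedDistribution.fourierMultiplierCLM_smul (h3.mul h4)]
  rfl

/-- The smoothing effect of the heat semigroup. -/
theorem norm_block_heat_apply_le_of_l1Holder (φ : DyadicCutoff d) {a σ T : ℝ} (ha : 0 ≤ a)
    (ha1 : a ≤ 1) (hσ : 0 ≤ σ + a) (hσ2 : σ + a ≤ 2) (hT : 0 < T) :
    ∃ C : ℝ, 0 ≤ C ∧ ∀ (D : Dist d) (Q : ℝ), 0 ≤ Q →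
      (∀ (ψ : 𝓢(Rd d, ℂ)) (P : ℝ), ∫ x, ‖ψ x‖ ≤ P → L1Holder a ψ P → ‖D ψ‖ ≤ Q * P) →
      ∀ s, 0 < s → s ≤ T → ∀ (k : ℕ) (ψ : 𝓢(Rd d, ℂ)),
        ‖block φ k (heat s D) ψ‖
          ≤ C * Q * s ^ (-((σ + a) / 2)) * (2 : ℝ) ^ (-(σ * k)) * ∫ x, ‖ψ x‖ := by
  set w : 𝓢(Rd d, ℂ) → ℝ := fun m => w11 (FourierTransform.fourier m : 𝓢(Rd d, ℂ)) with hw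
  have hw0 : ∀ m, 0 ≤ w m := fun m => w11_nonneg _
  set θ := (σ + a) / 2 with hθ
  have hθ0 : 0 ≤ θ := by positivity
  have hθ1 : θ ≤ 1 := by rw [hθ]; linarith
  set E := gaussianSymbol d
  set E' := laplaceGaussianSymbol d
  set C0 := 2 * w φ.base * w E * T ^ θ
  set C1 := 2 * w φ.annulus * w E
  set C2 := 2 * w φ.invAnnulus * w E'
  have hC0 : 0 ≤ C0 := by have := hw0 φ.base; have := hw0 E; positivity
  have hC1 : 0 ≤ C1 := by have := hw0 φ.annulus; have := hw0 E; positivity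
  have hC2 : 0 ≤ C2 := by have := hw0 φ.invAnnulus; have := hw0 E'; positivity
  refine ⟨C0 + C1 + C2, by positivity, fun D Q hQ hD s hs hsT k ψ => ?_⟩
  have hI : 0 ≤ ∫ x, ‖ψ x‖ := integral_nonneg fun x => norm_nonneg _
  have hsθ : 0 < s ^ (-θ) := by positivity
  cases k with
  | zero =>
    have e := block_heat_apply φ (k := 0) hs.le (c := 1) (l := 1) (r := √s) φ.base E
      (fun ξ => by simp [DyadicCutoff.profile, E]) D ψ
    have h1 := norm_apply_adjMult_adjMult_le (r := √s) ha ha1 hQ one_pos le_rfl hD φ.base E ψ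
    rw [e, one_mul]
    refine h1.trans ?_
    -- The lowest block gains nothing from smoothing; the singular factor is inserted at the price
    -- of `T ^ θ`.
    have h2 : 1 ≤ T ^ θ * s ^ (-θ) := by
      rw [Real.rpow_neg hs.le, ← div_eq_mul_inv, one_le_div (by positivity)]
      exact Real.rpow_le_rpow hs.le hsT hθ0
    simp only [inv_one, Real.one_rpow, mul_one, Nat.cast_zero, mul_zero, neg_zero, Real.rpow_zero]
    calc _ = 2 * w φ.base * w E * Q * 1 * ∫ x, ‖ψ x‖ := by simp only [hw]; ring
      _ ≤ 2 * w φ.base * w E * Q * (T ^ θ * s ^ (-θ)) * ∫ x, ‖ψ x‖ := by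
        have := hw0 φ.base; have := hw0 E
        gcongr
      _ = C0 * Q * s ^ (-θ) * ∫ x, ‖ψ x‖ := by ring
      _ ≤ (C0 + C1 + C2) * Q * s ^ (-θ) * ∫ x, ‖ψ x‖ := by gcongr; linarith
  | succ k =>
    set n := k + 1 with hn
    set l : ℝ := ((2 : ℝ) ^ n)⁻¹ with hl
    have hl0 : 0 < l := by positivity
    have hl1 : l ≤ 1 := inv_le_one_of_one_le₀ (one_le_pow₀ one_le_two)
    have e1 := block_heat_apply φ (k := n) hs.le (c := 1) (l := l) (r := √s) φ.annulus E
      (fun ξ => by simp [DyadicCutoff.profile, E, hn, hl]) D ψ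
    -- Dividing the cutoff and multiplying the Gaussian by the symbol of `-Δ` extracts the factor `l
    -- ^ 2 / s`.
    have e2 := block_heat_apply φ (k := n) hs.le (c := ((l ^ 2 / s : ℝ) : ℂ)) (l := l) (r := √s)
      φ.invAnnulus E' (fun ξ => by
        have h1 := φ.invAnnulus_mul (l • ξ)
        have h2 : (2 * Real.pi * ‖√s • ξ‖) ^ 2 = s / l ^ 2 * (2 * Real.pi * ‖l • ξ‖) ^ 2 := by
          rw [norm_smul, norm_smul, Real.norm_of_nonneg (Real.sqrt_nonneg s),
            Real.norm_of_nonneg hl0.le]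
          rw [show 2 * Real.pi * (√s * ‖ξ‖) = √s * (2 * Real.pi * ‖ξ‖) by ring, mul_pow,
            Real.sq_sqrt hs.le]
          field_simp
        have h3 : φ.profile n = φ.annulus := rfl
        rw [h3, ← hl, ← h1, laplaceGaussianSymbol_apply, h2]
        have : (s : ℂ) ≠ 0 := by exact_mod_cast hs.ne'
        have : (l : ℂ) ≠ 0 := by exact_mod_cast hl0.ne'
        push_cast
        field_simp) D ψ
    have b1 := norm_apply_adjMult_adjMult_le (r := √s) ha ha1 hQ hl0 hl1 hD φ.annulus E ψ
    have b2 := norm_apply_adjMult_adjMult_le (r := √s) ha ha1 hQ hl0 hl1 hD φ.invAnnulus E' ψ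
    set x := l ^ 2 / s with hx
    have hx0 : 0 < x := by positivity
    have hla : 0 < (l⁻¹) ^ a := by positivity
    -- The factorizations give the bounds `1` and `x` up to constants; since `0 ≤ θ ≤ 1`, the
    -- smaller of the two is at most `x ^ θ`.
    have key : ‖block φ n (heat s D) ψ‖ ≤ (C1 + C2) * Q * (l⁻¹) ^ a * (∫ x, ‖ψ x‖) * x ^ θ := by
      rcases le_total x 1 with h | h
      · have h1 : x ≤ x ^ θ := by
          simpa using Real.rpow_le_rpow_of_exponent_ge hx0 h hθ1
        rw [e2, norm_mul, Complex.norm_real, Real.norm_of_nonneg hx0.le]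
        calc _ ≤ x ^ θ * (C2 * Q * (l⁻¹) ^ a * ∫ x, ‖ψ x‖) := by
              gcongr
          _ = C2 * Q * (l⁻¹) ^ a * (∫ x, ‖ψ x‖) * x ^ θ := by ring
          _ ≤ _ := by gcongr; linarith
      · have h1 : 1 ≤ x ^ θ := Real.one_le_rpow h hθ0
        rw [e1, one_mul]
        calc _ ≤ C1 * Q * (l⁻¹) ^ a * (∫ x, ‖ψ x‖) * 1 := by rw [mul_one]; exact b1
          _ ≤ C1 * Q * (l⁻¹) ^ a * (∫ x, ‖ψ x‖) * x ^ θ := by gcongr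
          _ ≤ _ := by gcongr; linarith
    have hpow : (l⁻¹) ^ a * x ^ θ = s ^ (-θ) * (2 : ℝ) ^ (-(σ * (n : ℝ))) := by
      rw [hx, Real.div_rpow (by positivity) hs.le, Real.rpow_neg hs.le, hl, inv_inv, inv_pow,
        ← pow_mul, ← Real.rpow_natCast, ← Real.rpow_natCast, ← Real.rpow_mul (by norm_num),
        ← Real.rpow_neg (by norm_num), ← Real.rpow_mul (by norm_num), div_eq_mul_inv, ← mul_assoc,
        ← Real.rpow_add (by norm_num), mul_comm]
      congr 2
      rw [hθ]; push_cast; ring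
    refine key.trans ?_
    calc _ = (C1 + C2) * Q * (∫ x, ‖ψ x‖) * ((l⁻¹) ^ a * x ^ θ) := by ring
      _ = (C1 + C2) * Q * s ^ (-θ) * (2 : ℝ) ^ (-(σ * (n : ℝ))) * ∫ x, ‖ψ x‖ := by
        rw [hpow]; ring
      _ ≤ _ := by gcongr; linarith

/-! ### A priori bounds -/

theorem besovNorm_le_of_sub {φ : DyadicCutoff d} {γ N M : ℝ} (hN : 0 ≤ N) (hM : 0 ≤ M)
    {f g : Dist d} (hf : besovNorm φ γ f < ⊤) (hg : besovNorm φ γ g ≤ ENNReal.ofReal N)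
    (hfg : besovNorm φ γ (f - g) ≤ ENNReal.ofReal M) :
    besovNorm φ γ f ≤ ENNReal.ofReal (N + M) := by
  refine besovNorm_le fun j => linftyNorm_le_of_norm_apply_le (by positivity)
    (linftyNorm_block_lt_top hf j) fun ψ => ?_
  have h1 := norm_apply_le_of_linftyNorm_le (by positivity) (linftyNorm_block_le hg j) ψ
  have h2 := norm_apply_le_of_linftyNorm_le (by positivity) (linftyNorm_block_le hfg j) ψ
  have e : block φ j f ψ = block φ j g ψ + block φ j (f - g) ψ := by
    simp only [block, map_sub, sub_apply]; ring
  rw [e]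
  refine (norm_add_le _ _).trans ((add_le_add h1 h2).trans (le_of_eq ?_))
  ring

/-- Continuity gives local bounds, and compactness of the interval makes them global. The weighted
supremum of a solution is thereby finite and can be absorbed. -/
theorem MemCT.exists_bound {φ : DyadicCutoff d} {T γ : ℝ} {u : ℝ → Dist d} (hu : MemCT φ T γ u) :
    ∃ M : ℝ, ∀ t ∈ Set.Icc 0 T, besovNorm φ γ (u t) ≤ ENNReal.ofReal M := by
  have key : ∃ M : ℝ, ∀ t ∈ Set.Icc 0 T, t ∈ Set.Icc 0 T →
      besovNorm φ γ (u t) ≤ ENNReal.ofReal M := by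
    refine isCompact_Icc.induction_on
      (p := fun S => ∃ M : ℝ, ∀ t ∈ S, t ∈ Set.Icc 0 T → besovNorm φ γ (u t) ≤ ENNReal.ofReal M)
      ⟨0, fun t ht => absurd ht (Set.notMem_empty t)⟩ ?_ ?_ ?_
    · rintro S S' hS ⟨M, hM⟩
      exact ⟨M, fun t ht => hM t (hS ht)⟩
    · rintro S S' ⟨M, hM⟩ ⟨M', hM'⟩
      refine ⟨max M M', fun t ht htT => ?_⟩
      rcases ht with ht | ht
      · exact (hM t ht htT).trans (ENNReal.ofReal_le_ofReal (le_max_left _ _))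
      · exact (hM' t ht htT).trans (ENNReal.ofReal_le_ofReal (le_max_right _ _))
    · intro t ht
      have h1 : ∀ᶠ s in 𝓝[Set.Icc 0 T] t, besovNorm φ γ (u s - u t) ≤ ENNReal.ofReal 1 :=
        (hu.2 t ht).eventually_le_const (by simp)
      refine ⟨{s | besovNorm φ γ (u s - u t) ≤ ENNReal.ofReal 1}, h1,
        (besovNorm φ γ (u t)).toReal + 1, fun s hs hsT => ?_⟩
      exact besovNorm_le_of_sub ENNReal.toReal_nonneg zero_le_one (hu.1 s hsT).2
        (by rw [ENNReal.ofReal_toReal (hu.1 t ht).2.ne]) hs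
  exact key.imp fun M hM t ht => hM t ht ht

theorem norm_comp_grad_le (φ : DyadicCutoff d) {a α : ℝ} (ha : 0 ≤ a) (ha1 : a ≤ 1) (haα : a < α)
    {F : Rd d → ℝ} {L : ℝ≥0} (hF : LipschitzWith L F) :
    ∃ C : ℝ, 0 ≤ C ∧ ∀ (D : Dist d) (N : ℝ), 0 ≤ N → besovNorm φ (α + 1) D ≤ ENNReal.ofReal N →
      (Continuous fun x => ((F (grad D x) : ℝ) : ℂ)) ∧
      (∀ x, ‖((F (grad D x) : ℝ) : ℂ)‖ ≤ C * (1 + N)) ∧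
      ∀ x h, ‖((F (grad D (x + h)) : ℝ) : ℂ) - ((F (grad D x) : ℝ) : ℂ)‖
        ≤ C * (1 + N) * ‖h‖ ^ a := by
  obtain ⟨C, hC, hg⟩ := norm_gradient_le φ ha ha1 haα
  refine ⟨|F 0| + L * C, by positivity, fun D N hN hD => ?_⟩
  have h : Continuous (grad D) ∧ (∀ x, ‖grad D x‖ ≤ C * N) ∧
      ∀ x h, ‖grad D (x + h) - grad D x‖ ≤ C * N * ‖h‖ ^ a := by
    by_cases hex : ∃ g, IsGradient D g
    · rw [grad, dif_pos hex]
      exact ⟨hex.choose_spec.1, hg D N _ hN hD hex.choose_spec⟩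
    -- The default gradient `0` satisfies the same bounds, so the existence of a gradient is not
    -- needed.
    · rw [grad, dif_neg hex]
      refine ⟨continuous_zero, fun x => ?_, fun x h => ?_⟩
      · simp only [Pi.zero_apply, norm_zero]; positivity
      · simp only [Pi.zero_apply, sub_zero, norm_zero]; positivity
  obtain ⟨h1, h2, h3⟩ := h
  have hle : L * (C * N) ≤ (|F 0| + L * C) * (1 + N) := by
    have := abs_nonneg (F 0)
    have : 0 ≤ L * C := by positivity
    nlinarith [mul_nonneg (abs_nonneg (F 0)) hN]
  refine ⟨Complex.continuous_ofReal.comp (hF.continuous.comp h1), fun x => ?_, fun x h => ?_⟩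
  · have h4 : |F (grad D x) - F 0| ≤ L * ‖grad D x‖ := by
      simpa [dist_eq_norm] using hF.dist_le_mul (grad D x) 0
    rw [Complex.norm_real, Real.norm_eq_abs]
    have h5 := abs_sub_abs_le_abs_sub (F (grad D x)) (F 0)
    have h6 := mul_le_mul_of_nonneg_left (h2 x) L.2
    have : 0 ≤ L * C := by positivity
    have h7 : (L : ℝ) * ‖grad D x‖ ≤ L * (C * N) := h6
    nlinarith [mul_nonneg (abs_nonneg (F 0)) hN]
  · have h4 : |F (grad D (x + h)) - F (grad D x)| ≤ L * ‖grad D (x + h) - grad D x‖ := by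
      simpa [dist_eq_norm] using hF.dist_le_mul (grad D (x + h)) (grad D x)
    rw [← Complex.ofReal_sub, Complex.norm_real, Real.norm_eq_abs]
    have hh : 0 ≤ ‖h‖ ^ a := by positivity
    calc _ ≤ L * (C * N * ‖h‖ ^ a) := h4.trans (by gcongr; exact h3 x h)
      _ = L * (C * N) * ‖h‖ ^ a := by ring
      _ ≤ _ := mul_le_mul_of_nonneg_right hle hh

/-- Since `x^ε ≤ 1 + x ≤ e^x`, exponential decay can be traded for a weak power singularity; this
produces the small factor `ρ ^ (-ε)`. -/
theorem exp_neg_le_rpow_neg {x ε : ℝ} (hx : 0 < x) (hε : 0 ≤ ε) (hε1 : ε ≤ 1) :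
    Real.exp (-x) ≤ x ^ (-ε) := by
  rw [Real.exp_neg, Real.rpow_neg hx.le]
  refine inv_anti₀ (by positivity) ((rpow_le_one_add hx.le hε hε1).trans ?_)
  linarith [Real.add_one_le_exp x]

theorem integral_sub_rpow_neg_le {t T κ : ℝ} (ht : 0 ≤ t) (htT : t ≤ T) (hκ : κ < 1) :
    IntervalIntegrable (fun r => (t - r) ^ (-κ)) volume 0 t ∧
      ∫ r in (0 : ℝ)..t, (t - r) ^ (-κ) ≤ T ^ (1 - κ) / (1 - κ) := by
  constructor
  · have := (intervalIntegral.intervalIntegrable_rpow' (a := 0) (b := t)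
      (show -1 < -κ by linarith)).comp_sub_left t
    simpa using this.symm
  · rw [intervalIntegral.integral_comp_sub_left (fun x => x ^ (-κ)) t, sub_self, sub_zero,
      integral_rpow (Or.inl (by linarith)), Real.zero_rpow (by linarith), sub_zero,
      show -κ + 1 = 1 - κ by ring]
    have : 0 < 1 - κ := by linarith
    gcongr

/-- One step of the a priori estimate: a bound on `u` of exponential growth in time is improved. -/
theorem besovNorm_mild_le (φ : DyadicCutoff d) {F : Rd d → ℝ} {α β T : ℝ} {b : ℝ → Dist d}
    {u₀ : Dist d} (hβ0 : β < 0) (hβ : max (-α) (α - 1) < β)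
    (hT : 0 < T) (hb : essSup (fun r => besovNorm φ β (b r)) (volume.restrict (Set.Icc 0 T)) < ⊤)
    {L : ℝ≥0} (hF : LipschitzWith L F) (hu₀ : besovNorm φ (α + 1) u₀ < ⊤) :
    ∃ C₀ C₁ ε : ℝ, 0 ≤ C₀ ∧ 0 ≤ C₁ ∧ 0 < ε ∧ ∀ lam ∈ Set.Icc (0 : ℝ) 1, ∀ u : ℝ → Dist d,
      MemCT φ T (α + 1) u → IsMildSolution φ F T lam b u₀ u → ∀ N ρ : ℝ, 0 ≤ N → 0 < ρ →
      (∀ r ∈ Set.Icc 0 T, besovNorm φ (α + 1) (u r) ≤ ENNReal.ofReal (N * Real.exp (ρ * r))) →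
      ∀ t ∈ Set.Icc 0 T, besovNorm φ (α + 1) (u t)
        ≤ ENNReal.ofReal (C₀ + C₁ * ρ ^ (-ε) * (1 + N) * Real.exp (ρ * t)) := by
  obtain ⟨hβ1, hβ2⟩ := max_lt_iff.1 hβ
  -- The three constraints on `a` are: above `-β` for the product, below `α` for the gradient, below
  -- `1 - α` for integrability of the heat singularity.
  obtain ⟨a, ha, ha2⟩ := exists_between (show -β < min α (1 - α) from
    lt_min (by linarith) (by linarith))
  obtain ⟨haα, ha3⟩ := lt_min_iff.1 ha2
  have ha0 : 0 ≤ a := by linarith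
  have ha1 : a ≤ 1 := by linarith
  set θ := (α + 1 + a) / 2 with hθ
  have hθ0 : 0 < θ := by rw [hθ]; linarith
  have hθ1 : θ < 1 := by rw [hθ]; linarith
  -- Half of the room below exponent `1`, so that `κ = θ + ε` is still integrable.
  set ε := (1 - θ) / 2 with hε
  have hε0 : 0 < ε := by rw [hε]; linarith
  have hε1 : ε ≤ 1 := by rw [hε]; linarith
  set κ := θ + ε with hκ
  have hκ1 : κ < 1 := by rw [hκ, hε]; linarith
  obtain ⟨Cg, hCg, hgrad⟩ := norm_comp_grad_le φ ha0 ha1 haα hF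
  obtain ⟨Cb, hCb, hbony⟩ := norm_bonyMul_apply_le φ (β := β) ha0 ha1 (by linarith)
  obtain ⟨Ch, hCh, hheat⟩ := norm_block_heat_apply_le_of_l1Holder φ (σ := α + 1) (T := T) ha0 ha1
    (by linarith) (by linarith) hT
  set B := (essSup (fun r => besovNorm φ β (b r)) (volume.restrict (Set.Icc 0 T))).toReal
  have hB0 : 0 ≤ B := ENNReal.toReal_nonneg
  have hbB : ∀ᵐ r, r ∈ Set.Icc 0 T → besovNorm φ β (b r) ≤ ENNReal.ofReal B := by
    rw [← ae_restrict_iff' measurableSet_Icc, ENNReal.ofReal_toReal hb.ne]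
    exact ENNReal.ae_le_essSup _
  set N₀ := (besovNorm φ (α + 1) u₀).toReal
  have hN₀ : 0 ≤ N₀ := ENNReal.toReal_nonneg
  have hu₀N : besovNorm φ (α + 1) u₀ ≤ ENNReal.ofReal N₀ := by rw [ENNReal.ofReal_toReal hu₀.ne]
  set W := w11 (FourierTransform.fourier (gaussianSymbol d) : 𝓢(Rd d, ℂ))
  have hW : 0 ≤ W := w11_nonneg _
  set Cq := Ch * (Cb * Cg * B) with hCq
  have hCq0 : 0 ≤ Cq := by positivity
  set I := T ^ (1 - κ) / (1 - κ) with hI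
  have hI0 : 0 ≤ I := div_nonneg (by positivity) (by linarith)
  refine ⟨W * N₀, Cq * I, ε, by positivity, by positivity, hε0,
    fun lam hlam u hu hmild N ρ hN hρ hbound t ht => ?_⟩
  have hE : 0 < Real.exp (ρ * t) := Real.exp_pos _
  refine besovNorm_le fun k => linftyNorm_le_of_norm_apply_le (by positivity)
    (linftyNorm_block_lt_top (hu.1 t ht).2 k) fun ψ => ?_
  set S := (2 : ℝ) ^ (-((α + 1) * k)) with hS
  have hS0 : 0 < S := by positivity
  have hψ0 : 0 ≤ ∫ x, ‖ψ x‖ := integral_nonneg fun x => norm_nonneg _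
  set ψ' := adjMult (fun ξ => ((φ.part k ξ : ℝ) : ℂ)) ψ with hψ'
  have hblock : ∀ D : Dist d, D ψ' = block φ k D ψ := fun D => rfl
  have h1 : ‖heat t u₀ ψ'‖ ≤ W * (N₀ * S) * ∫ x, ‖ψ x‖ := by
    rw [hblock]
    exact norm_block_heat_apply_le φ (by positivity) ht.1 (linftyNorm_block_le hu₀N k) ψ
  obtain ⟨hint, hintle⟩ := integral_sub_rpow_neg_le ht.1 ht.2 hκ1
  set G := Cq * (1 + N) * Real.exp (ρ * t) * ρ ^ (-ε) * S * ∫ x, ‖ψ x‖ with hG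
  have hG0 : 0 ≤ G := by positivity
  have h2 : ‖∫ r in (0 : ℝ)..t, heat (t - r) (bonyMul φ (compGrad F (u r)) (b r)) ψ'‖
      ≤ ∫ r in (0 : ℝ)..t, G * (t - r) ^ (-κ) := by
    -- Only an almost everywhere bound by an integrable function is required. The endpoint `r = t`
    -- is discarded, because the smoothing estimate needs a positive time.
    refine intervalIntegral.norm_integral_le_of_norm_le ht.1 ?_ (hint.const_mul G)
    filter_upwards [hbB, (Set.countable_singleton t).ae_notMem volume] with r hr hrt hr0
    have hrt' : r < t := lt_of_le_of_ne hr0.2 hrt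
    have hrT : r ∈ Set.Icc 0 T := ⟨hr0.1.le, hrt'.le.trans ht.2⟩
    have hs : 0 < t - r := by linarith
    have hNr : 0 ≤ N * Real.exp (ρ * r) := by positivity
    obtain ⟨g1, g2, g3⟩ := hgrad (u r) _ hNr (hbound r hrT)
    have h3 := hbony _ _ (b r) B g1 g2 g3 hB0 (hr hrT)
    have h4 := hheat (bonyMul φ (compGrad F (u r)) (b r))
      (Cb * (Cg * (1 + N * Real.exp (ρ * r))) * B) (by positivity) h3 (t - r) hs
      (by linarith [ht.2, hr0.1]) k ψ
    rw [hblock]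
    refine h4.trans ?_
    -- The growth at time `r` is rewritten as growth at time `t` times `e^{-ρ(t-r)}`, which pays for
    -- `ρ ^ (-ε)`.
    have h5 : 1 + N * Real.exp (ρ * r)
        ≤ (1 + N) * (Real.exp (ρ * t) * (ρ ^ (-ε) * (t - r) ^ (-ε))) := by
      have e1 : Real.exp (ρ * r) = Real.exp (ρ * t) * Real.exp (-(ρ * (t - r))) := by
        rw [← Real.exp_add]; congr 1; ring
      have e2 := exp_neg_le_rpow_neg (mul_pos hρ hs) hε0.le hε1
      rw [Real.mul_rpow hρ.le hs.le] at e2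
      have e3 : 1 ≤ Real.exp (ρ * r) := Real.one_le_exp (mul_nonneg hρ.le hrT.1)
      calc 1 + N * Real.exp (ρ * r) ≤ (1 + N) * Real.exp (ρ * r) := by linarith
        _ ≤ _ := by rw [e1]; gcongr
    have h6 : (t - r) ^ (-κ) = (t - r) ^ (-ε) * (t - r) ^ (-((α + 1 + a) / 2)) := by
      rw [← Real.rpow_add hs]; congr 1; rw [hκ, hθ]; ring
    have hsθ : 0 < (t - r) ^ (-((α + 1 + a) / 2)) := by positivity
    calc _ = Cq * (1 + N * Real.exp (ρ * r)) * (t - r) ^ (-((α + 1 + a) / 2)) * S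
          * ∫ x, ‖ψ x‖ := by rw [hCq]; ring
      _ ≤ Cq * ((1 + N) * (Real.exp (ρ * t) * (ρ ^ (-ε) * (t - r) ^ (-ε))))
          * (t - r) ^ (-((α + 1 + a) / 2)) * S * ∫ x, ‖ψ x‖ := by gcongr
      _ = _ := by rw [hG, h6]; ring
  rw [intervalIntegral.integral_const_mul] at h2
  have h3 := h2.trans (mul_le_mul_of_nonneg_left hintle hG0)
  have hl : ‖(lam : ℂ)‖ ≤ 1 := by
    rw [Complex.norm_real, Real.norm_of_nonneg hlam.1]; exact hlam.2
  rw [← hblock, hmild t ht ψ']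
  calc _ ≤ ‖(lam : ℂ)‖ * ‖heat t u₀ ψ'‖ + ‖(lam : ℂ)‖ *
        ‖∫ r in (0 : ℝ)..t, heat (t - r) (bonyMul φ (compGrad F (u r)) (b r)) ψ'‖ := by
        rw [← norm_mul, ← norm_mul]; exact norm_add_le _ _
    _ ≤ 1 * (W * (N₀ * S) * ∫ x, ‖ψ x‖) + 1 * (G * I) := by gcongr
    _ = _ := by rw [hG]; ring

/-- For large `ρ` the one-step estimate has slope at most `1/2` in the weighted norm, so the
supremum is absorbed; undoing the weight costs `e^{ρT}`. -/
theorem exists_bound_mild (φ : DyadicCutoff d) {F : Rd d → ℝ} {α β T : ℝ} {b : ℝ → Dist d}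
    {u₀ : Dist d} (hβ0 : β < 0) (hβ : max (-α) (α - 1) < β)
    (hT : 0 < T) (hb : essSup (fun r => besovNorm φ β (b r)) (volume.restrict (Set.Icc 0 T)) < ⊤)
    {L : ℝ≥0} (hF : LipschitzWith L F) (hu₀ : besovNorm φ (α + 1) u₀ < ⊤) :
    ∃ K : ℝ, 0 ≤ K ∧ ∀ lam ∈ Set.Icc (0 : ℝ) 1, ∀ u : ℝ → Dist d,
      MemCT φ T (α + 1) u → IsMildSolution φ F T lam b u₀ u →
      ∀ t ∈ Set.Icc 0 T, besovNorm φ (α + 1) (u t) ≤ ENNReal.ofReal K := by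
  obtain ⟨C₀, C₁, ε, hC₀, hC₁, hε, hstep⟩ :=
    besovNorm_mild_le φ hβ0 hβ hT hb hF hu₀
  obtain ⟨ρ, hρ, hρ0⟩ : ∃ ρ : ℝ, C₁ * ρ ^ (-ε) ≤ 1 / 2 ∧ 0 < ρ := by
    have h : Tendsto (fun ρ : ℝ => C₁ * ρ ^ (-ε)) atTop (𝓝 0) := by
      simpa using (tendsto_rpow_neg_atTop hε).const_mul C₁
    exact ((h.eventually_le_const (by norm_num)).and (eventually_gt_atTop 0)).exists
  refine ⟨(2 * C₀ + 1) * Real.exp (ρ * T), by positivity, fun lam hlam u hu hmild => ?_⟩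
  obtain ⟨M, hM⟩ := hu.exists_bound
  set n : ℝ → ℝ := fun t => (besovNorm φ (α + 1) (u t)).toReal with hn
  have hun : ∀ t ∈ Set.Icc 0 T, besovNorm φ (α + 1) (u t) = ENNReal.ofReal (n t) :=
    fun t ht => (ENNReal.ofReal_toReal (hu.1 t ht).2.ne).symm
  have hn0 : ∀ t, 0 ≤ n t := fun t => ENNReal.toReal_nonneg
  have hexp : ∀ t ∈ Set.Icc 0 T, Real.exp (-(ρ * t)) ≤ 1 := fun t ht =>
    Real.exp_le_one_iff.2 (by have := mul_nonneg hρ0.le ht.1; linarith)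
  set S : Set ℝ := (fun t => Real.exp (-(ρ * t)) * n t) '' Set.Icc 0 T with hS
  have hSb : BddAbove S := by
    refine ⟨max M 0, ?_⟩
    rintro _ ⟨t, ht, rfl⟩
    have h1 : n t ≤ max M 0 := by
      refine ENNReal.toReal_le_of_le_ofReal (le_max_right _ _) ((hM t ht).trans ?_)
      exact ENNReal.ofReal_le_ofReal (le_max_left _ _)
    exact (mul_le_of_le_one_left (hn0 t) (hexp t ht)).trans h1
  have h0T : (0 : ℝ) ∈ Set.Icc 0 T := ⟨le_rfl, hT.le⟩
  have hSne : S.Nonempty := ⟨_, 0, h0T, rfl⟩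
  set N := sSup S with hNdef
  have hle : ∀ t ∈ Set.Icc 0 T, n t ≤ N * Real.exp (ρ * t) := fun t ht => by
    have h1 : Real.exp (-(ρ * t)) * n t ≤ N := le_csSup hSb ⟨t, ht, rfl⟩
    rw [Real.exp_neg, inv_mul_le_iff₀ (Real.exp_pos _)] at h1
    linarith
  have hN0 : 0 ≤ N := by
    have h1 := (hn0 0).trans (hle 0 h0T)
    simpa using h1
  have hN : N ≤ 2 * C₀ + 1 := by
    -- The step is applied with the optimal `N` itself, which is legitimate because the supremum is
    -- finite.
    have h1 : N ≤ C₀ + 1 / 2 * (1 + N) := by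
      refine csSup_le hSne ?_
      rintro _ ⟨t, ht, rfl⟩
      have hE := Real.exp_pos (ρ * t)
      have hC0' : 0 ≤ C₀ + C₁ * ρ ^ (-ε) * (1 + N) * Real.exp (ρ * t) := by positivity
      have h2 := hstep lam hlam u hu hmild N ρ hN0 hρ0
        (fun r hr => by rw [hun r hr]; exact ENNReal.ofReal_le_ofReal (hle r hr)) t ht
      have h3 : n t ≤ _ := ENNReal.toReal_le_of_le_ofReal hC0' h2
      have h4 : Real.exp (-(ρ * t)) * Real.exp (ρ * t) = 1 := by
        rw [← Real.exp_add]; simp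
      have hE' := Real.exp_pos (-(ρ * t))
      calc Real.exp (-(ρ * t)) * n t
          ≤ Real.exp (-(ρ * t)) * (C₀ + C₁ * ρ ^ (-ε) * (1 + N) * Real.exp (ρ * t)) := by gcongr
        _ = Real.exp (-(ρ * t)) * C₀ + C₁ * ρ ^ (-ε) * (1 + N)
            * (Real.exp (-(ρ * t)) * Real.exp (ρ * t)) := by ring
        _ ≤ 1 * C₀ + 1 / 2 * (1 + N) * 1 := by
            rw [h4]
            have := hexp t ht
            gcongr
        _ = _ := by ring
    linarith
  intro t ht
  rw [hun t ht]
  refine ENNReal.ofReal_le_ofReal ((hle t ht).trans ?_)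
  have := ht.2
  gcongr

end RoughPDE

end

theorem mainTheorem7 (d : ℕ) (φ : RoughPDE.DyadicCutoff d)
    (F : RoughPDE.Rd d → ℝ) (α β T : ℝ)
    (b : ℝ → RoughPDE.Dist d) (u₀ : RoughPDE.Dist d)
    -- A1: `F` is continuously differentiable with Lipschitz partial derivatives
    (hF_diff : ContDiff ℝ 1 F)
    (hF_partial : ∃ L : ℝ≥0, ∀ i : Fin d,
      LipschitzWith L (fun x => fderiv ℝ F x (EuclideanSpace.single i (1 : ℝ))))
    -- A2: parameters
    (hα0 : 0 < α) (hα1 : α < 1) (hβ0 : β < 0) (hβ : max (-α) (α - 1) < β)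
    (hT : 0 < T)
    -- A3: `b ∈ L^∞([0,T]; C^β)`
    (hb : RoughPDE.MemLinftyT φ T β b)
    -- A4: `F` is globally Lipschitz
    (hF_lip : ∃ L : ℝ≥0, LipschitzWith L F)
    (hu₀ : RoughPDE.MemC φ (α + 1) u₀) :
    ∃ K : ℝ≥0, ∀ lam ∈ Set.Icc (0 : ℝ) 1, ∀ u : ℝ → RoughPDE.Dist d,
      RoughPDE.MemCT φ T (α + 1) u →
      RoughPDE.IsMildSolution φ F T lam b u₀ u →
        (∀ t ∈ Set.Icc (0 : ℝ) T, RoughPDE.besovNorm φ (α + 1) (u t) ≤ (K : ℝ≥0∞)) ∧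
          RoughPDE.normCT φ T (α + 1) u ≤ (K : ℝ≥0∞) := by
  obtain ⟨L, hL⟩ := hF_lip
  obtain ⟨K, hK0, hK⟩ := RoughPDE.exists_bound_mild φ hβ0 hβ hT hb.2.2 hL hu₀.2
  refine ⟨K.toNNReal, fun lam hlam u hu hmild => ?_⟩
  have h := hK lam hlam u hu hmild
  exact ⟨h, iSup₂_le h⟩
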